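/- Let $T>0$, $m\in\mathbb N$, and let $\alpha_0>\alpha_1>\dots>\alpha_m\ge 0$ be real numbers; let $n_i$ be the non-negative integer with $n_i-1<\alpha_i\le n_i$. Let $a_1,\dots,a_m$ be real functions on $[0,T]$ and consider $$ {}^cD^{\alpha_0}y(t)=-\sum_{i=1}^m a_i(t)\,{}^cD^{\alpha_i}y(t),\qquad 0<t<T. \tag{1}$$ Notation. For $\alpha>0$, $I^{\alpha}f(t)=\frac1{\Gamma(\alpha)}\int_0^t(t-\tau)^{\alpha-1}f(\tau)\,d\tau$, and $I^0f=f$. For $\alpha\ge0$ and the integer $n\ge 0$ with $n-1<\alpha\le n$, $D^{\alpha}f=\frac{d^n}{dt^n}I^{n-\alpha}f$ $(t>0)$ is the Riemann–Liouville derivative and ${}^cD^{\alpha}f=D^{\alpha}\bigl[f-\sum_{k=0}^{n-1}\frac{f^{(k)}(0)}{k!}t^k\bigr]$ is the Caputo derivative. For $0\le\gamma<1$, $C_\gamma[0,T]$ is the space of functions $f$ on $(0,T]$ such that $t^{\gamma}f(t)$ extends to a continuous function on $[0,T]$ (so $C_0[0,T]=C[0,T]$). For $n\ge1$, $C^n_\gamma[0,T]$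 is the space of functions that are $n-1$ times continuously differentiable on $[0,T]$ and whose $n$-th derivative exists on $(0,T]$ and lies in $C_\gamma[0,T]$; its norm is $\sum_{k<n}\sup_{[0,T]}|f^{(k)}|+\sup_{(0,T]}|t^{\gamma}f^{(n)}(t)|$. A canonical fundamental system of (1) is a family $y_0,\dots,y_{n_0-1}$ of solutions of (1) with $y_j^{(k)}(0+)=\delta_{jk}$ for $j,k=0,\dots,n_0-1$. Put $H_j=\{i\in\{1,\dots,m\}: 0\le\alpha_i\le j\}$, $h_j=\min H_j$ if $H_j\ne\emptyset$, $\Phi_{j+1}(t)=t^j/j!$, and $\Phi_{j+1-\alpha_i}=D^{\alpha_i}\Phi_{j+1}$. **Theorem 1.** Assume that $H_0\neq\emptyset$ (equivalently, $m\ge1$ and $\alpha_m=0$), that $n_0=n_1$, and, with $\gamma=n_0-\alpha_0\in[0,1)$, that $a_i\in C^1_\gamma[0,T]$ and $D^{\gamma}a_i\in C[0,T]$ for $i=1,\dots,m$. Then (1) has exactly one canonical fundamental system $y_0,\dots,y_{n_0-1}$ consisting of functions in $C^{n_0}_\gamma[0,T]$, and for $j=0,\dots,n_0-1$ $$ y_j=\Phi_{j+1}+\sum_{k=0}^{\infty}(-1)^{k+1}I^{\alpha_0}\Bigl[\sum_{i=1}^m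 a_iI^{\alpha_0-\alpha_i}\Bigr]^k\sum_{i=h_j}^m a_i\Phi_{j+1-\alpha_i}, \tag{5}$$ where the series converges in $C^{n_0}_\gamma[0,T]$. -/

import Mathlib

open Set Filter Topology

noncomputable section

/-- `f ∈ C_γ[0,T]`: `f` is considered on `(0,T]`, and `t ↦ t ^ γ * f t` is (extends to) a continuous
function on `[0,T]`. For `γ = 0` this is `C[0,T]`. -/
def MemWeightedC (γ T : ℝ) (f : ℝ → ℝ) : Prop :=
  ∃ g : ℝ → ℝ, ContinuousOn g (Icc 0 T) ∧ ∀ t ∈ Ioc 0 T, t ^ γ * f t = g t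

/-- `f ∈ C^n_γ[0,T]`: `f` is `n - 1` times continuously differentiable on `[0,T]`, the `n`-th
derivative exists on `(0,T]` and belongs to `C_γ[0,T]`; and `C^0_γ[0,T] = C_γ[0,T]`. -/
def MemWeightedCn (γ T : ℝ) : ℕ → (ℝ → ℝ) → Prop
  | 0, f => MemWeightedC γ T f
  | k + 1, f =>
      ContDiffOn ℝ (k : ℕ) f (Icc 0 T) ∧
      (∀ t ∈ Ioc 0 T,
        DifferentiableWithinAt ℝ (iteratedDerivWithin k f (Icc 0 T)) (Icc 0 T) t) ∧
      MemWeightedC γ T (iteratedDerivWithin (k + 1) f (Icc 0 T))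

/-- Convergence of the sequence `F` to `f` in the normed space `C^n_γ[0,T]`, whose norm is the sum
of the sup norms on `[0,T]` of the derivatives of order `< n` and of the sup norm on `(0,T]` of
`t ^ γ` times the `n`-th derivative. -/
def TendstoInWeightedCn (γ T : ℝ) (n : ℕ) (F : ℕ → ℝ → ℝ) (f : ℝ → ℝ) : Prop :=
  (∀ N, MemWeightedCn γ T n (F N)) ∧ MemWeightedCn γ T n f ∧
  (∀ k < n, TendstoUniformlyOn (fun N => iteratedDerivWithin k (F N) (Icc 0 T))
    (iteratedDerivWithin k f (Icc 0 T)) atTop (Icc 0 T)) ∧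
  TendstoUniformlyOn (fun N t => t ^ γ * iteratedDerivWithin n (F N) (Icc 0 T) t)
    (fun t => t ^ γ * iteratedDerivWithin n f (Icc 0 T) t) atTop (Ioc 0 T)

/-- Riemann–Liouville fractional integral of order `α ≥ 0`; `I^0 f = f`. -/
def rlIntegral (α : ℝ) (f : ℝ → ℝ) (t : ℝ) : ℝ :=
  if α = 0 then f t
  else 1 / Real.Gamma α * ∫ τ in (0 : ℝ)..t, (t - τ) ^ (α - 1) * f τ

/-- Riemann–Liouville fractional derivative of order `α ≥ 0` on `(0,T]`: the `n`-th derivative of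
`I^(n-α) f`, where `n = ⌈α⌉`, i.e. `n - 1 < α ≤ n`. -/
def rlDeriv (α T : ℝ) (f : ℝ → ℝ) (t : ℝ) : ℝ :=
  iteratedDerivWithin ⌈α⌉₊ (rlIntegral (⌈α⌉₊ - α) f) (Ioc 0 T) t

/-- The Riemann–Liouville derivative of order `α` exists at all points of `(0,T)`: the function
`I^(n-α) f` is `n` times differentiable there. -/
def HasRLDeriv (α T : ℝ) (f : ℝ → ℝ) : Prop :=
  ∀ k < ⌈α⌉₊, DifferentiableOn ℝ
    (iteratedDerivWithin k (rlIntegral (⌈α⌉₊ - α) f) (Ioc 0 T)) (Ioo 0 T)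

/-- `f` minus its Taylor polynomial at `0` of degree `n - 1` (one-sided derivatives on `[0,T]`). -/
def subTaylor (n : ℕ) (T : ℝ) (f : ℝ → ℝ) (t : ℝ) : ℝ :=
  f t - ∑ k ∈ Finset.range n, iteratedDerivWithin k f (Icc 0 T) 0 / (k.factorial : ℝ) * t ^ k

/-- Caputo fractional derivative of order `α ≥ 0` on `(0,T]`. -/
def caputoDeriv (α T : ℝ) (f : ℝ → ℝ) (t : ℝ) : ℝ :=
  rlDeriv α T (subTaylor ⌈α⌉₊ T f) t

/-- The Caputo derivative of order `α` exists at all points of `(0,T)`. -/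
def HasCaputoDeriv (α T : ℝ) (f : ℝ → ℝ) : Prop :=
  HasRLDeriv α T (subTaylor ⌈α⌉₊ T f)

/-- `y` solves `ᶜD^(α 0) y = - ∑_{i=1}^m a i * ᶜD^(α i) y` on `(0,T)`. -/
def IsSolution (m : ℕ) (α : ℕ → ℝ) (a : ℕ → ℝ → ℝ) (T : ℝ) (y : ℝ → ℝ) : Prop :=
  (∀ i ≤ m, HasCaputoDeriv (α i) T y) ∧
  ∀ t ∈ Ioo 0 T,
    caputoDeriv (α 0) T y t = -∑ i ∈ Finset.Icc 1 m, a i t * caputoDeriv (α i) T y t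

/-- `y 0, …, y (n₀ - 1)` is a canonical fundamental system of the equation: every `y j` is a
solution, and the limit at `0+` of its `k`-th derivative is `δ_{jk}`. -/
def IsCanonicalFundamentalSystem (m : ℕ) (α : ℕ → ℝ) (a : ℕ → ℝ → ℝ) (T : ℝ) (n₀ : ℕ)
    (y : Fin n₀ → ℝ → ℝ) : Prop :=
  ∀ j : Fin n₀, IsSolution m α a T (y j) ∧
    ∀ k : Fin n₀, Tendsto (iteratedDerivWithin (k : ℕ) (y j) (Icc 0 T)) (𝓝[>] 0)
      (𝓝 (if j = k then 1 else 0))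

/-- `H_j = {i : 0 ≤ α i ≤ j, i = 1, …, m}`. -/
def lowOrders (m : ℕ) (α : ℕ → ℝ) (j : ℕ) : Set ℕ :=
  {i | 1 ≤ i ∧ i ≤ m ∧ 0 ≤ α i ∧ α i ≤ j}

/-- `h_j = min H_j` (used for nonempty `H_j`). -/
def minLowOrder (m : ℕ) (α : ℕ → ℝ) (j : ℕ) : ℕ := sInf (lowOrders m α j)

/-- `Φ_{j+1}(t) = t ^ j / j!`. -/
def phi (j : ℕ) (t : ℝ) : ℝ := t ^ j / (j.factorial : ℝ)

/-- `Φ_{j+1-β} = D^β Φ_{j+1}`, the Riemann–Liouville derivative. -/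
def phiFrac (j : ℕ) (β T : ℝ) (t : ℝ) : ℝ := rlDeriv β T (phi j) t

/-- The operator `∑_{i=1}^m a i * I^(α 0 - α i)`. -/
def neumannOp (m : ℕ) (α : ℕ → ℝ) (a : ℕ → ℝ → ℝ) (f : ℝ → ℝ) (t : ℝ) : ℝ :=
  ∑ i ∈ Finset.Icc 1 m, a i t * rlIntegral (α 0 - α i) f t

/-- The function `∑_{i=h_j}^m a i * Φ_{j+1-α i}`. -/
def neumannSeed (m : ℕ) (α : ℕ → ℝ) (a : ℕ → ℝ → ℝ) (T : ℝ) (j : ℕ) (t : ℝ) : ℝ :=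
  ∑ i ∈ Finset.Icc (minLowOrder m α j) m, a i t * phiFrac j (α i) T t

/-- The partial sums of the series
`Φ_{j+1} + ∑_{k≥0} (-1)^(k+1) I^(α 0) [∑_{i=1}^m a i I^(α 0 - α i)]^k ∑_{i=h_j}^m a i Φ_{j+1-α i}`. -/
def neumannPartialSum (m : ℕ) (α : ℕ → ℝ) (a : ℕ → ℝ → ℝ) (T : ℝ) (j N : ℕ) (t : ℝ) : ℝ :=
  phi j t + ∑ k ∈ Finset.range N,
    (-1) ^ (k + 1) * rlIntegral (α 0) ((neumannOp m α a)^[k] (neumannSeed m α a T j)) t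

end

open MeasureTheory ProbabilityTheory

/-! A function in C^n_γ (n = n₀) with the initial values of Φ_{j+1} is Φ_{j+1} + I^n w with w =
y^(n) in C_γ. Its Caputo derivative of order α_i is I^(n-α_i) w, plus Φ_{j+1-α_i} exactly when α_i ≤
j. With v = I^γ w and L = ∑ a_i I^(α₀-α_i), the equation becomes the Volterra equation v = -(seed +
L v) (`isSolution_iff`), whose formal solution is the alternating Neumann series.

The difficulty is regularity: v must be I^γ of a function in C_γ, so L has to preserve the range of
I^γ. Since fractional integrals commute, it suffices that multiplication by a ∈ C^1_γ preserves this
range (`exists_isFracDerivOf_mul`). For γ > 0 this follows from Marchaud's form of a fractional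
Leibniz rule, D^γ(a v)(t) = a(t) D^γ v(t) + γ/Γ(1-γ) ∫₀ᵗ v(s) (a(t) - a(s)) (t-s)^(-γ-1) ds. The
rule is a Beta integral identity for powers; both sides are bounded bilinear maps of (a', D^γ v), so
the Weierstrass theorem extends it to all of C_γ (`isFracDerivOf_fracDerivMul`).

Thus L lifts to an operator w ↦ w' on C_γ. Because α₀ - α_i > 0, this lift halves the norm sup
|e^(-lt) t^γ w(t)| for large l (`exists_isFracDerivOf_neumannOp`). The lifted series therefore
converges geometrically in C_γ, and I^n carries it to the series for y_j in C^n_γ, because I^α₀ I^γ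
= I^n. The same exponential weight forces a bounded solution of v = -L v to vanish, which gives
uniqueness. -/

/-! ### Beta integrals as majorants. -/

theorem integral_rpow_mul_sub_rpow {p q t : ℝ} (hp : 0 < p) (hq : 0 < q) (ht : 0 < t) :
    ∫ s in (0 : ℝ)..t, s ^ (p - 1) * (t - s) ^ (q - 1) = beta p q * t ^ (p + q - 1) := by
  have h := Complex.betaIntegral_scaled (p : ℂ) (q : ℂ) ht
  have e : ∫ s in (0 : ℝ)..t, (s : ℂ) ^ ((p : ℂ) - 1) * ((t : ℂ) - s) ^ ((q : ℂ) - 1) =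
      ∫ s in (0 : ℝ)..t, ((s ^ (p - 1) * (t - s) ^ (q - 1) : ℝ) : ℂ) := by
    refine intervalIntegral.integral_congr_ae (ae_of_all _ fun s hs => ?_)
    rw [uIoc_of_le ht.le] at hs
    rw [Complex.ofReal_mul, Complex.ofReal_cpow hs.1.le, Complex.ofReal_cpow (by linarith [hs.2])]
    push_cast
    rfl
  rw [e, intervalIntegral.integral_ofReal, Complex.betaIntegral_eq_Gamma_mul_div _ _ (by simpa)
    (by simpa), ← Complex.ofReal_add, Complex.Gamma_ofReal, Complex.Gamma_ofReal,
    Complex.Gamma_ofReal] at h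
  have e2 : ((t : ℂ) ^ (((p + q : ℝ) : ℂ) - 1)) = ((t ^ (p + q - 1) : ℝ) : ℂ) := by
    rw [Complex.ofReal_cpow ht.le]; push_cast; rfl
  rw [e2] at h
  rw [beta, mul_comm]
  exact_mod_cast h

theorem intervalIntegrable_rpow_mul_sub_rpow {p q t : ℝ} (hp : 0 < p) (hq : 0 < q) (ht : 0 < t) :
    IntervalIntegrable (fun s : ℝ => s ^ (p - 1) * (t - s) ^ (q - 1)) volume 0 t := by
  by_contra h
  have h1 := integral_rpow_mul_sub_rpow hp hq ht
  -- A non-integrable function has integral 0 by convention, whereas the Beta value is positive.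
  rw [intervalIntegral.integral_undef h] at h1
  have : 0 < beta p q * t ^ (p + q - 1) := mul_pos (beta_pos hp hq) (Real.rpow_pos_of_pos ht _)
  linarith

/-- The Beta kernel dominates functions singular at both ends, so continuity is only asked on the
open interval. -/
theorem intervalIntegrable_of_abs_le_rpow {p q t C : ℝ} (hp : 0 < p) (hq : 0 < q) (ht : 0 < t)
    {f : ℝ → ℝ} (hc : ContinuousOn f (Ioo 0 t))
    (hb : ∀ s ∈ Ioo 0 t, |f s| ≤ C * (s ^ (p - 1) * (t - s) ^ (q - 1))) :
    IntervalIntegrable f volume 0 t := by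
  have h := (intervalIntegrable_rpow_mul_sub_rpow hp hq ht).const_mul C
  rw [intervalIntegrable_iff_integrableOn_Ioo_of_le ht.le] at h ⊢
  refine Integrable.mono' h (hc.aestronglyMeasurable measurableSet_Ioo) ?_
  exact (ae_restrict_mem measurableSet_Ioo).mono fun s hs => hb s hs

theorem abs_integral_le_rpow {p q t C : ℝ} (hp : 0 < p) (hq : 0 < q) (ht : 0 < t)
    {f : ℝ → ℝ} (hb : ∀ s ∈ Ioo 0 t, |f s| ≤ C * (s ^ (p - 1) * (t - s) ^ (q - 1))) :
    |∫ s in (0 : ℝ)..t, f s| ≤ C * (beta p q * t ^ (p + q - 1)) := by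
  have h := (intervalIntegrable_rpow_mul_sub_rpow hp hq ht).const_mul C
  rw [← integral_rpow_mul_sub_rpow hp hq ht, ← intervalIntegral.integral_const_mul]
  rw [intervalIntegrable_iff_integrableOn_Ioo_of_le ht.le] at h
  rw [intervalIntegral.integral_of_le ht.le, intervalIntegral.integral_of_le ht.le,
    integral_Ioc_eq_integral_Ioo, integral_Ioc_eq_integral_Ioo]
  exact norm_integral_le_of_norm_le (f := f) h
    ((ae_restrict_mem measurableSet_Ioo).mono fun s hs => hb s hs)

theorem integral_congr_Ioo {t : ℝ} (ht : 0 ≤ t) {f g : ℝ → ℝ} (h : EqOn f g (Ioo 0 t)) :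
    ∫ s in (0 : ℝ)..t, f s = ∫ s in (0 : ℝ)..t, g s := by
  rw [intervalIntegral.integral_of_le ht, intervalIntegral.integral_of_le ht,
    integral_Ioc_eq_integral_Ioo, integral_Ioc_eq_integral_Ioo]
  exact setIntegral_congr_fun measurableSet_Ioo h

/-! ### The spaces C_γ[0,T]. -/

theorem MemWeightedC.continuousOn {γ T : ℝ} {f : ℝ → ℝ} (hf : MemWeightedC γ T f) :
    ContinuousOn f (Ioc 0 T) := by
  obtain ⟨g, hg, h⟩ := hf
  have : ContinuousOn (fun t => t ^ (-γ) * g t) (Ioc 0 T) := by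
    refine ContinuousOn.mul (fun t ht => ?_) (hg.mono Ioc_subset_Icc_self)
    exact (Real.continuousAt_rpow_const t (-γ) (Or.inl ht.1.ne')).continuousWithinAt
  refine this.congr fun t ht => ?_
  simp only
  rw [← h t ht, ← mul_assoc, ← Real.rpow_add ht.1]
  simp

theorem abs_le_rpow_neg_iff {γ t X y : ℝ} (ht : 0 < t) : |y| ≤ X * t ^ (-γ) ↔ |t ^ γ * y| ≤ X := by
  have h := Real.rpow_pos_of_pos ht γ
  rw [abs_mul, abs_of_pos h, Real.rpow_neg ht.le, ← div_eq_mul_inv, le_div_iff₀ h, mul_comm]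

theorem MemWeightedC.exists_bound {γ T : ℝ} {f : ℝ → ℝ} (hf : MemWeightedC γ T f) :
    ∃ X, 0 ≤ X ∧ ∀ t ∈ Ioc 0 T, |f t| ≤ X * t ^ (-γ) := by
  obtain ⟨g, hg, h⟩ := hf
  obtain ⟨C, hC⟩ := isCompact_Icc.exists_bound_of_continuousOn hg
  refine ⟨max C 0, le_max_right _ _, fun t ht => ?_⟩
  rw [abs_le_rpow_neg_iff ht.1, h t ht]
  exact (hC t (Ioc_subset_Icc_self ht)).trans (le_max_left _ _)

theorem MemWeightedC.congr {γ T : ℝ} {f g : ℝ → ℝ} (hf : MemWeightedC γ T f)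
    (h : EqOn g f (Ioc 0 T)) : MemWeightedC γ T g := by
  obtain ⟨k, hk, h'⟩ := hf
  exact ⟨k, hk, fun t ht => by rw [h ht, h' t ht]⟩

theorem MemWeightedC.add {γ T : ℝ} {f g : ℝ → ℝ} (hf : MemWeightedC γ T f)
    (hg : MemWeightedC γ T g) : MemWeightedC γ T (fun t => f t + g t) := by
  obtain ⟨k, hk, h⟩ := hf
  obtain ⟨l, hl, h'⟩ := hg
  exact ⟨fun t => k t + l t, hk.add hl, fun t ht => by rw [mul_add, h t ht, h' t ht]⟩

theorem MemWeightedC.continuousOn_mul {γ T : ℝ} {f a : ℝ → ℝ} (ha : ContinuousOn a (Icc 0 T))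
    (hf : MemWeightedC γ T f) : MemWeightedC γ T (fun t => a t * f t) := by
  obtain ⟨k, hk, h⟩ := hf
  exact ⟨fun t => a t * k t, ha.mul hk, fun t ht => by simp only [← h t ht]; ring⟩

theorem MemWeightedC.const_mul {γ T : ℝ} {f : ℝ → ℝ} (c : ℝ)
    (hf : MemWeightedC γ T f) : MemWeightedC γ T (fun t => c * f t) :=
  MemWeightedC.continuousOn_mul continuousOn_const hf

theorem memWeightedC_zero (γ T : ℝ) : MemWeightedC γ T (fun _ => 0) :=
  ⟨fun _ => 0, continuousOn_const, by simp⟩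

theorem MemWeightedC.sub {γ T : ℝ} {f g : ℝ → ℝ} (hf : MemWeightedC γ T f)
    (hg : MemWeightedC γ T g) : MemWeightedC γ T (fun t => f t - g t) :=
  (hf.add (hg.const_mul (-1))).congr fun t _ => by simp only; ring

theorem MemWeightedC.sum {γ T : ℝ} {ι : Type*} (s : Finset ι) {f : ι → ℝ → ℝ}
    (hf : ∀ i ∈ s, MemWeightedC γ T (f i)) : MemWeightedC γ T (fun t => ∑ i ∈ s, f i t) := by
  classical
  induction s using Finset.induction_on with
  | empty => simpa using memWeightedC_zero γ T
  | insert i s hi ih =>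
    refine ((hf i (Finset.mem_insert_self _ _)).add
      (ih fun j hj => hf j (Finset.mem_insert_of_mem hj))).congr fun t _ => ?_
    simp only [Finset.sum_insert hi]

theorem memWeightedC_rpow_neg_mul {γ T : ℝ} {ξ : ℝ → ℝ} (hξ : ContinuousOn ξ (Icc 0 T)) :
    MemWeightedC γ T (fun t => t ^ (-γ) * ξ t) :=
  ⟨ξ, hξ, fun t ht => by rw [← mul_assoc, ← Real.rpow_add ht.1]; simp⟩

/-- Factoring out t^(-γ) leaves a continuous function on [0,T], to which polynomial approximation
applies. -/
theorem MemWeightedC.exists_eqOn {γ T : ℝ} {f : ℝ → ℝ} (hf : MemWeightedC γ T f) :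
    ∃ ξ, ContinuousOn ξ (Icc 0 T) ∧ EqOn f (fun t => t ^ (-γ) * ξ t) (Ioc 0 T) := by
  obtain ⟨g, hg, h⟩ := hf
  refine ⟨g, hg, fun t ht => ?_⟩
  simp only
  rw [← h t ht, ← mul_assoc, ← Real.rpow_add ht.1]
  simp

/-- A continuous function on `[0,T]` belongs to every space with non-negative weight. -/
theorem ContinuousOn.memWeightedC {γ T : ℝ} (hγ : 0 ≤ γ) {f : ℝ → ℝ}
    (hf : ContinuousOn f (Icc 0 T)) : MemWeightedC γ T f :=
  ⟨fun t => t ^ γ * f t, ContinuousOn.mul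
    (fun t _ => (Real.continuousAt_rpow_const t γ (Or.inr hγ)).continuousWithinAt) hf,
    fun _ _ => rfl⟩

/-! ### Fractional integrals: linearity, powers and pointwise bounds. -/

theorem rlIntegral_zero (f : ℝ → ℝ) : rlIntegral 0 f = f := by
  funext t; simp [rlIntegral]

theorem rlIntegral_of_ne {α : ℝ} (hα : α ≠ 0) (f : ℝ → ℝ) (t : ℝ) :
    rlIntegral α f t = 1 / Real.Gamma α * ∫ τ in (0 : ℝ)..t, (t - τ) ^ (α - 1) * f τ := by
  simp [rlIntegral, hα]

theorem rlIntegral_one (f : ℝ → ℝ) (t : ℝ) : rlIntegral 1 f t = ∫ τ in (0 : ℝ)..t, f τ := by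
  simp [rlIntegral]

theorem rlIntegral_apply_zero {α : ℝ} (hα : α ≠ 0) (f : ℝ → ℝ) : rlIntegral α f 0 = 0 := by
  simp [rlIntegral, hα]

theorem rlIntegral_congr_Ioo {α t : ℝ} (hα : α ≠ 0) (ht : 0 ≤ t) {f g : ℝ → ℝ}
    (h : EqOn f g (Ioo 0 t)) : rlIntegral α f t = rlIntegral α g t := by
  rw [rlIntegral_of_ne hα, rlIntegral_of_ne hα, integral_congr_Ioo ht]
  intro s hs
  simp only [h hs]

/-- The right endpoint has to be included because I^0 evaluates the function there. -/
theorem rlIntegral_congr {α t : ℝ} (ht : 0 < t) {f g : ℝ → ℝ}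
    (h : EqOn f g (Ioc 0 t)) : rlIntegral α f t = rlIntegral α g t := by
  by_cases hα : α = 0
  · subst hα; rw [rlIntegral_zero, rlIntegral_zero]; exact h ⟨ht, le_rfl⟩
  · exact rlIntegral_congr_Ioo hα ht.le (h.mono Ioo_subset_Ioc_self)

theorem rlIntegral_eqOn {α T : ℝ} {f g : ℝ → ℝ} (h : EqOn f g (Ioc 0 T)) :
    EqOn (rlIntegral α f) (rlIntegral α g) (Ioc 0 T) := fun _ ht =>
  rlIntegral_congr ht.1 (h.mono (Ioc_subset_Ioc_right ht.2))

theorem rlIntegral_rpow {α p t : ℝ} (hα : 0 ≤ α) (hp : 0 < p) (ht : 0 < t) :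
    rlIntegral α (fun s => s ^ (p - 1)) t =
      Real.Gamma p / Real.Gamma (p + α) * t ^ (p + α - 1) := by
  rcases hα.eq_or_lt with rfl | hα
  · rw [rlIntegral_zero]; simp [div_self (Real.Gamma_pos_of_pos hp).ne']
  · rw [rlIntegral_of_ne hα.ne']
    have : ∀ s : ℝ, (t - s) ^ (α - 1) * s ^ (p - 1) = s ^ (p - 1) * (t - s) ^ (α - 1) :=
      fun s => mul_comm _ _
    simp_rw [this]
    rw [integral_rpow_mul_sub_rpow hp hα ht, beta]
    have := (Real.Gamma_pos_of_pos hα).ne'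
    field_simp

/-- Comparison with the fractional integral of X s^(-γ), a Beta integral. For α = γ the bound is
constant in t, so I^γ maps C_γ to bounded functions. -/
theorem abs_rlIntegral_le {α γ t X : ℝ} (hα : 0 ≤ α) (hγ : γ < 1) (ht : 0 < t) {f : ℝ → ℝ}
    (hf : ∀ s ∈ Ioc 0 t, |f s| ≤ X * s ^ (-γ)) :
    |rlIntegral α f t| ≤ X * (Real.Gamma (1 - γ) / Real.Gamma (1 - γ + α)) * t ^ (α - γ) := by
  rcases hα.eq_or_lt with rfl | hα
  · rw [rlIntegral_zero]
    have := (Real.Gamma_pos_of_pos (sub_pos.2 hγ)).ne'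
    simpa [div_self this] using hf t ⟨ht, le_rfl⟩
  · rw [rlIntegral_of_ne hα.ne', abs_mul]
    have hG := Real.Gamma_pos_of_pos hα
    rw [abs_of_pos (by positivity)]
    have := abs_integral_le_rpow (C := X) (f := fun τ => (t - τ) ^ (α - 1) * f τ) (sub_pos.2 hγ)
      hα ht (by
        intro s hs
        have h1 : 0 ≤ (t - s) ^ (α - 1) := Real.rpow_nonneg (by linarith [hs.2]) _
        rw [abs_mul, abs_of_nonneg h1]
        have := mul_le_mul_of_nonneg_left (hf s ⟨hs.1, hs.2.le⟩) h1
        rw [show 1 - γ - 1 = -γ by ring]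
        linarith)
    calc _ ≤ 1 / Real.Gamma α * (X * (beta (1 - γ) α * t ^ (1 - γ + α - 1))) := by gcongr
      _ = _ := by
        rw [beta, show 1 - γ + α - 1 = α - γ by ring]
        field_simp

theorem MemWeightedC.intervalIntegrable {α γ T t : ℝ} (hα : 0 < α) (hγ : γ < 1)
    (ht : t ∈ Ioc 0 T) {f : ℝ → ℝ} (hf : MemWeightedC γ T f) :
    IntervalIntegrable (fun τ => (t - τ) ^ (α - 1) * f τ) volume 0 t := by
  obtain ⟨X, -, hX⟩ := hf.exists_bound
  refine intervalIntegrable_of_abs_le_rpow (C := X) (sub_pos.2 hγ) hα ht.1 ?_ ?_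
  · refine ContinuousOn.mul (fun s hs => ?_)
      (hf.continuousOn.mono fun s hs => ⟨hs.1, hs.2.le.trans ht.2⟩)
    exact ((continuousAt_const.sub continuousAt_id).rpow_const
      (Or.inl (sub_pos.2 hs.2).ne')).continuousWithinAt
  · intro s hs
    have h1 : 0 ≤ (t - s) ^ (α - 1) := Real.rpow_nonneg (by linarith [hs.2]) _
    rw [abs_mul, abs_of_nonneg h1]
    have := mul_le_mul_of_nonneg_left (hX s ⟨hs.1, hs.2.le.trans ht.2⟩) h1
    rw [show 1 - γ - 1 = -γ by ring]
    linarith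

theorem rlIntegral_add {α γ T t : ℝ} (hα : 0 ≤ α) (hγ : γ < 1) (ht : t ∈ Ioc 0 T) {f g : ℝ → ℝ}
    (hf : MemWeightedC γ T f) (hg : MemWeightedC γ T g) :
    rlIntegral α (fun s => f s + g s) t = rlIntegral α f t + rlIntegral α g t := by
  rcases hα.eq_or_lt with rfl | hα
  · simp [rlIntegral_zero]
  · simp_rw [rlIntegral_of_ne hα.ne', mul_add]
    rw [intervalIntegral.integral_add (hf.intervalIntegrable hα hγ ht)
      (hg.intervalIntegrable hα hγ ht), mul_add]

theorem rlIntegral_const_mul {α : ℝ} (c t : ℝ) (f : ℝ → ℝ) :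
    rlIntegral α (fun s => c * f s) t = c * rlIntegral α f t := by
  by_cases hα : α = 0
  · simp [hα, rlIntegral_zero]
  · simp_rw [rlIntegral_of_ne hα]
    have : ∀ τ : ℝ, (t - τ) ^ (α - 1) * (c * f τ) = c * ((t - τ) ^ (α - 1) * f τ) :=
      fun τ => by ring
    simp_rw [this]
    rw [intervalIntegral.integral_const_mul]
    ring

theorem rlIntegral_sub {α γ T t : ℝ} (hα : 0 ≤ α) (hγ : γ < 1) (ht : t ∈ Ioc 0 T) {f g : ℝ → ℝ}
    (hf : MemWeightedC γ T f) (hg : MemWeightedC γ T g) :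
    rlIntegral α (fun s => f s - g s) t = rlIntegral α f t - rlIntegral α g t := by
  have h := rlIntegral_add hα hγ ht hf (hg.const_mul (-1))
  rw [rlIntegral_const_mul] at h
  rw [show (fun s => f s - g s) = fun s => f s + -1 * g s by funext s; ring, h]
  ring

theorem rlIntegral_zero_fun (α t : ℝ) : rlIntegral α (fun _ => 0) t = 0 := by
  simp [rlIntegral]

theorem rlIntegral_sum {α γ T t : ℝ} (hα : 0 ≤ α) (hγ : γ < 1) (ht : t ∈ Ioc 0 T) {ι : Type*}
    (s : Finset ι) {f : ι → ℝ → ℝ} (hf : ∀ i ∈ s, MemWeightedC γ T (f i)) :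
    rlIntegral α (fun r => ∑ i ∈ s, f i r) t = ∑ i ∈ s, rlIntegral α (f i) t := by
  classical
  induction s using Finset.induction_on with
  | empty => simpa using rlIntegral_zero_fun α t
  | insert i s hi ih =>
    have h1 := hf i (Finset.mem_insert_self _ _)
    have h2 := fun j hj => hf j (Finset.mem_insert_of_mem (a := j) (b := i) hj)
    simp_rw [Finset.sum_insert hi]
    rw [rlIntegral_add hα hγ ht h1 (MemWeightedC.sum s h2), ih h2]

/-! ### Weierstrass approximation; mapping and semigroup properties of I^α on C_γ. -/

/-- Induction principle for continuous functions on a compact interval, from the Weierstrass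
approximation theorem. -/
theorem continuousOn_Icc_induction {a b : ℝ} {P : (ℝ → ℝ) → Prop} (mono : ∀ k : ℕ, P fun t => t ^ k)
    (add : ∀ f g, ContinuousOn f (Icc a b) → ContinuousOn g (Icc a b) → P f → P g →
      P fun t => f t + g t)
    (smul : ∀ (c : ℝ) f, ContinuousOn f (Icc a b) → P f → P fun t => c * f t)
    (lim : ∀ f, ContinuousOn f (Icc a b) → (∀ ε > 0, ∃ g, ContinuousOn g (Icc a b) ∧ P g ∧
      ∀ t ∈ Icc a b, |f t - g t| ≤ ε) → P f) {f : ℝ → ℝ} (hf : ContinuousOn f (Icc a b)) : P f := by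
  have poly : ∀ p : Polynomial ℝ, P fun t => p.eval t := by
    intro p
    have mono' : ∀ (n : ℕ) (c : ℝ), P fun t => (Polynomial.C c * Polynomial.X ^ n).eval t := by
      intro n c
      simpa using smul c _ (continuousOn_pow n) (mono n)
    induction p using Polynomial.induction_on with
    | C c => simpa using mono' 0 c
    | add p q hp hq =>
      simpa using add _ _ p.continuous.continuousOn q.continuous.continuousOn hp hq
    | monomial n c _ => exact mono' _ c
  refine lim f hf fun ε hε => ?_
  obtain ⟨p, hp⟩ := exists_polynomial_near_of_continuousOn a b f hf ε hε
  exact ⟨_, p.continuous.continuousOn, poly p, fun t ht => by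
    rw [abs_sub_comm]; exact (hp t ht).le⟩

/-- C_γ is closed under uniform convergence with weight t^γ: the limit, times the weight, is
uniformly continuous on (0,T] and hence extends to 0. -/
theorem MemWeightedC.of_approx {γ T : ℝ} (hT : 0 < T) {f : ℝ → ℝ}
    (h : ∀ ε > 0, ∃ g, MemWeightedC γ T g ∧ ∀ t ∈ Ioc 0 T, |f t - g t| ≤ ε * t ^ (-γ)) :
    MemWeightedC γ T f := by
  set F : ℝ → ℝ := fun t => t ^ γ * f t with hF
  have huc : UniformContinuousOn F (Ioc 0 T) := by
    rw [Metric.uniformContinuousOn_iff]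
    intro ε hε
    obtain ⟨g, ⟨k, hk, hgk⟩, hg⟩ := h (ε / 3) (by positivity)
    have hku := isCompact_Icc.uniformContinuousOn_of_continuous hk
    rw [Metric.uniformContinuousOn_iff] at hku
    obtain ⟨δ, hδ, hkδ⟩ := hku (ε / 3) (by positivity)
    have hFk : ∀ t ∈ Ioc 0 T, |F t - k t| ≤ ε / 3 := fun t ht => by
      rw [← hgk t ht, hF]
      simp only
      rw [← mul_sub, ← abs_le_rpow_neg_iff ht.1]
      exact hg t ht
    refine ⟨δ, hδ, fun x hx y hy hxy => ?_⟩
    have h1 := hkδ x (Ioc_subset_Icc_self hx) y (Ioc_subset_Icc_self hy) hxy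
    rw [Real.dist_eq] at h1 ⊢
    have h2 := abs_le.1 (hFk x hx)
    have h3 := abs_le.1 (hFk y hy)
    have h4 := abs_lt.1 h1
    rw [abs_lt]
    constructor <;> linarith [h2.1, h2.2, h3.1, h3.2, h4.1, h4.2]
  have hne : (𝓝[Ioc (0 : ℝ) T] 0).NeBot := by
    rw [← mem_closure_iff_nhdsWithin_neBot, closure_Ioc hT.ne]
    exact left_mem_Icc.2 hT.le
  have hcau : Cauchy (𝓝[Ioc (0 : ℝ) T] 0) := cauchy_nhds.mono nhdsWithin_le_nhds
  obtain ⟨l, hl⟩ := cauchy_iff_exists_le_nhds.1 (hcau.map_of_le huc inf_le_right)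
  refine ⟨Function.update F 0 l, ?_, fun t ht => ?_⟩
  · rw [continuousOn_update_iff, Icc_sdiff_left]
    exact ⟨huc.continuousOn, fun _ => hl⟩
  · rw [Function.update_of_ne ht.1.ne']

/-- The norm bound of the fractional integral of order `α` on `C_γ[0,T]`. -/
noncomputable def rlIntegralBound (α γ T : ℝ) : ℝ := Real.Gamma (1 - γ) / Real.Gamma (1 - γ + α) * T ^ α

theorem rlIntegralBound_nonneg {α γ T : ℝ} (hα : 0 ≤ α) (hγ : γ < 1) (hT : 0 < T) :
    0 ≤ rlIntegralBound α γ T := by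
  have h1 := Real.Gamma_pos_of_pos (sub_pos.2 hγ)
  have h2 := Real.Gamma_pos_of_pos (add_pos_of_pos_of_nonneg (sub_pos.2 hγ) hα)
  unfold rlIntegralBound
  positivity

theorem abs_rlIntegral_le_bound {α γ T t X : ℝ} (hα : 0 ≤ α) (hγ : γ < 1) (ht : t ∈ Ioc 0 T)
    (hX : 0 ≤ X) {f : ℝ → ℝ} (hf : ∀ s ∈ Ioc 0 t, |f s| ≤ X * s ^ (-γ)) :
    |rlIntegral α f t| ≤ X * rlIntegralBound α γ T * t ^ (-γ) := by
  refine (abs_rlIntegral_le hα hγ ht.1 hf).trans ?_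
  have h1 := Real.Gamma_pos_of_pos (sub_pos.2 hγ)
  have h2 := Real.Gamma_pos_of_pos (add_pos_of_pos_of_nonneg (sub_pos.2 hγ) hα)
  have h3 := Real.rpow_pos_of_pos ht.1 (-γ)
  rw [sub_eq_add_neg α γ, Real.rpow_add ht.1, rlIntegralBound]
  have h4 : t ^ α ≤ T ^ α := Real.rpow_le_rpow ht.1.le ht.2 hα
  calc _ = X * (Real.Gamma (1 - γ) / Real.Gamma (1 - γ + α) * t ^ α) * t ^ (-γ) := by ring
    _ ≤ _ := by gcongr

theorem abs_rlIntegral_sub_le {α γ T t X : ℝ} (hα : 0 ≤ α) (hγ : γ < 1) (ht : t ∈ Ioc 0 T)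
    (hX : 0 ≤ X) {f g : ℝ → ℝ} (hf : MemWeightedC γ T f) (hg : MemWeightedC γ T g)
    (h : ∀ s ∈ Ioc 0 T, |f s - g s| ≤ X * s ^ (-γ)) :
    |rlIntegral α f t - rlIntegral α g t| ≤ X * rlIntegralBound α γ T * t ^ (-γ) := by
  rw [← rlIntegral_sub hα hγ ht hf hg]
  exact abs_rlIntegral_le_bound hα hγ ht hX fun s hs => h s ⟨hs.1, hs.2.trans ht.2⟩

theorem rpow_neg_mul_pow {γ t : ℝ} (ht : 0 < t) (k : ℕ) :
    t ^ (-γ) * t ^ k = t ^ ((k : ℝ) + 1 - γ - 1) := by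
  rw [← Real.rpow_natCast, ← Real.rpow_add ht]
  congr 1
  ring

theorem rlIntegral_rpow_neg_mul_pow {α γ t : ℝ} (hα : 0 ≤ α) (hγ : γ < 1) (ht : 0 < t) (k : ℕ) :
    rlIntegral α (fun s => s ^ (-γ) * s ^ k) t =
      Real.Gamma (k + 1 - γ) / Real.Gamma (k + 1 - γ + α) * t ^ (k + 1 - γ + α - 1) := by
  have hk : (0 : ℝ) ≤ k := k.cast_nonneg
  rw [← rlIntegral_rpow hα (by linarith) ht]
  exact rlIntegral_congr ht fun s hs => rpow_neg_mul_pow hs.1 k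

theorem memWeightedC_rpow {γ T p : ℝ} (hp : 0 ≤ p + γ) : MemWeightedC γ T (fun t => t ^ p) :=
  ⟨fun t => t ^ (p + γ), fun t _ =>
    (Real.continuousAt_rpow_const t (p + γ) (Or.inr hp)).continuousWithinAt, fun t ht => by
      rw [← Real.rpow_add ht.1, add_comm]⟩

/-- Closes the limit step of density arguments: an identity holds if its defect is O(ε) for every ε.
-/
theorem eq_zero_of_forall_abs_le_mul {x C : ℝ} (hC : 0 ≤ C) (h : ∀ ε > 0, |x| ≤ ε * C) : x = 0 := by
  rcases hC.eq_or_lt with rfl | hC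
  · simpa using h 1 one_pos
  · by_contra hx
    have := h (|x| / (2 * C)) (div_pos (abs_pos.2 hx) (by positivity))
    have h2 : |x| / (2 * C) * C = |x| / 2 := by field_simp
    linarith [abs_pos.2 hx]

theorem abs_rpow_neg_mul_sub_le {γ T ε : ℝ} {ξ ζ : ℝ → ℝ} (h : ∀ t ∈ Icc 0 T, |ξ t - ζ t| ≤ ε) :
    ∀ s ∈ Ioc 0 T, |s ^ (-γ) * ξ s - s ^ (-γ) * ζ s| ≤ ε * s ^ (-γ) := by
  intro s hs
  have := Real.rpow_pos_of_pos hs.1 (-γ)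
  rw [← mul_sub, abs_mul, abs_of_pos this, mul_comm]
  exact mul_le_mul_of_nonneg_right (h s (Ioc_subset_Icc_self hs)) this.le

/-- A power s^(k-γ) goes to a multiple of s^(k-γ+α), which lies in C_γ; the general case follows by
linearity, boundedness and closedness of C_γ. -/
theorem MemWeightedC.rlIntegral {α γ T : ℝ} (hα : 0 ≤ α) (hγ : γ < 1) (hT : 0 < T) {f : ℝ → ℝ}
    (hf : MemWeightedC γ T f) : MemWeightedC γ T (rlIntegral α f) := by
  obtain ⟨ξ, hξ, hfξ⟩ := hf.exists_eqOn
  refine MemWeightedC.congr ?_ (rlIntegral_eqOn hfξ)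
  clear hfξ hf
  refine continuousOn_Icc_induction (a := 0) (b := T)
    (P := fun ξ => MemWeightedC γ T (_root_.rlIntegral α fun t => t ^ (-γ) * ξ t)) ?_ ?_ ?_ ?_ hξ
  · intro k
    have hk : (0 : ℝ) ≤ k := k.cast_nonneg
    refine ((memWeightedC_rpow (γ := γ) (p := k + 1 - γ + α - 1) (by linarith)).const_mul _).congr
      fun t ht => rlIntegral_rpow_neg_mul_pow hα hγ ht.1 k
  · intro f g hf hg h1 h2
    refine (h1.add h2).congr fun t ht => ?_
    simp only
    rw [← rlIntegral_add hα hγ ht (memWeightedC_rpow_neg_mul hf) (memWeightedC_rpow_neg_mul hg)]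
    congr 1
    funext s
    ring
  · intro c f hf h
    refine (h.const_mul c).congr fun t ht => ?_
    simp only
    rw [← rlIntegral_const_mul]
    congr 1
    funext s
    ring
  · intro f hf h
    refine MemWeightedC.of_approx hT fun ε hε => ?_
    have hB := rlIntegralBound_nonneg hα hγ hT
    obtain ⟨g, hg, hPg, hfg⟩ := h (ε / (rlIntegralBound α γ T + 1)) (by positivity)
    refine ⟨_, hPg, fun t ht => ?_⟩
    refine (abs_rlIntegral_sub_le hα hγ ht (by positivity) (memWeightedC_rpow_neg_mul hf)
      (memWeightedC_rpow_neg_mul hg) (abs_rpow_neg_mul_sub_le hfg)).trans ?_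
    refine mul_le_mul_of_nonneg_right ?_ (Real.rpow_pos_of_pos ht.1 _).le
    rw [div_mul_eq_mul_div, div_le_iff₀ (by positivity)]
    nlinarith

/-- The semigroup property of the fractional integrals on `C_γ[0,T]`. -/
theorem rlIntegral_rlIntegral {α β γ T : ℝ} (hα : 0 ≤ α) (hβ : 0 ≤ β) (hγ : γ < 1) {f : ℝ → ℝ}
    (hf : MemWeightedC γ T f) :
    EqOn (rlIntegral α (rlIntegral β f)) (rlIntegral (α + β) f) (Ioc 0 T) := by
  intro t ht
  have hT : 0 < T := ht.1.trans_le ht.2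
  obtain ⟨ξ, hξ, hfξ⟩ := hf.exists_eqOn
  rw [rlIntegral_eqOn (rlIntegral_eqOn hfξ) ht, rlIntegral_eqOn hfξ ht]
  clear hfξ hf
  have hM : ∀ {ξ}, ContinuousOn ξ (Icc 0 T) →
      MemWeightedC γ T (rlIntegral β fun s => s ^ (-γ) * ξ s) :=
    fun hξ => (memWeightedC_rpow_neg_mul hξ).rlIntegral hβ hγ hT
  -- Both sides are linear and bounded in ξ, so only powers need a computation, and there the Gamma
  -- quotients telescope.
  refine continuousOn_Icc_induction (a := 0) (b := T)
    (P := fun ξ => rlIntegral α (rlIntegral β fun s => s ^ (-γ) * ξ s) t =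
      rlIntegral (α + β) (fun s => s ^ (-γ) * ξ s) t) ?_ ?_ ?_ ?_ hξ
  · intro k
    have hk : (0 : ℝ) ≤ k := k.cast_nonneg
    have h1 := (Real.Gamma_pos_of_pos (show 0 < (k : ℝ) + 1 - γ by linarith)).ne'
    have h2 := (Real.Gamma_pos_of_pos (show 0 < (k : ℝ) + 1 - γ + β by linarith)).ne'
    rw [rlIntegral_eqOn (T := T) (fun s hs => rlIntegral_rpow_neg_mul_pow hβ hγ hs.1 k) ht,
      rlIntegral_const_mul, rlIntegral_rpow hα (by linarith) ht.1,
      rlIntegral_rpow_neg_mul_pow (by linarith) hγ ht.1]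
    rw [show (k : ℝ) + 1 - γ + β + α = k + 1 - γ + (α + β) by ring]
    field_simp
  · intro f g hf hg h1 h2
    simp_rw [mul_add]
    rw [rlIntegral_add (by linarith) hγ ht (memWeightedC_rpow_neg_mul hf)
      (memWeightedC_rpow_neg_mul hg), ← h1, ← h2, ← rlIntegral_add hα hγ ht (hM hf) (hM hg)]
    exact rlIntegral_eqOn (fun s hs => rlIntegral_add hβ hγ hs (memWeightedC_rpow_neg_mul hf)
      (memWeightedC_rpow_neg_mul hg)) ht
  · intro c f hf h
    have e : (fun s => s ^ (-γ) * (c * f s)) = fun s => c * (s ^ (-γ) * f s) := by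
      funext s; ring
    rw [e, rlIntegral_const_mul, ← h, ← rlIntegral_const_mul]
    congr 1
    funext s
    rw [rlIntegral_const_mul]
  · intro f hf h
    rw [← sub_eq_zero]
    have hBα := rlIntegralBound_nonneg hα hγ hT
    have hBβ := rlIntegralBound_nonneg hβ hγ hT
    have hBαβ := rlIntegralBound_nonneg (add_nonneg hα hβ) hγ hT
    have htp := (Real.rpow_pos_of_pos ht.1 (-γ)).le
    refine eq_zero_of_forall_abs_le_mul (C := (rlIntegralBound β γ T * rlIntegralBound α γ T +
      rlIntegralBound (α + β) γ T) * t ^ (-γ)) (by positivity) fun ε hε => ?_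
    obtain ⟨g, hg, hPg, hfg⟩ := h ε hε
    have h1 := abs_rlIntegral_sub_le (add_nonneg hα hβ) hγ ht hε.le (memWeightedC_rpow_neg_mul hf)
      (memWeightedC_rpow_neg_mul hg) (abs_rpow_neg_mul_sub_le hfg)
    have h2 := abs_rlIntegral_sub_le hα hγ ht (X := ε * rlIntegralBound β γ T) (by positivity)
      (hM hf) (hM hg) fun s hs => abs_rlIntegral_sub_le hβ hγ hs hε.le
        (memWeightedC_rpow_neg_mul hf) (memWeightedC_rpow_neg_mul hg) (abs_rpow_neg_mul_sub_le hfg)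
    rw [hPg] at h2
    rw [abs_le] at h1 h2 ⊢
    constructor <;> linarith [h1.1, h1.2, h2.1, h2.2]

/-! ### The range of I^γ on C_γ. -/

/-- `z ∈ C_γ[0,T]` is a fractional derivative of order `γ` of `f`, i.e. `I^γ z = f` on `(0,T]`. -/
def IsFracDerivOf (γ T : ℝ) (z f : ℝ → ℝ) : Prop :=
  MemWeightedC γ T z ∧ EqOn (rlIntegral γ z) f (Ioc 0 T)

namespace IsFracDerivOf

variable {γ T : ℝ} {z w f g : ℝ → ℝ}

theorem congr (h : IsFracDerivOf γ T z f) (hw : EqOn w z (Ioc 0 T)) (hg : EqOn g f (Ioc 0 T)) :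
    IsFracDerivOf γ T w g :=
  ⟨h.1.congr hw, fun t ht => by rw [rlIntegral_eqOn hw ht, h.2 ht, hg ht]⟩

theorem add (h0 : 0 ≤ γ) (h1 : γ < 1) (hz : IsFracDerivOf γ T z f) (hw : IsFracDerivOf γ T w g) :
    IsFracDerivOf γ T (fun t => z t + w t) (fun t => f t + g t) :=
  ⟨hz.1.add hw.1, fun t ht => by rw [rlIntegral_add h0 h1 ht hz.1 hw.1, hz.2 ht, hw.2 ht]⟩

theorem const_mul (c : ℝ) (hz : IsFracDerivOf γ T z f) :
    IsFracDerivOf γ T (fun t => c * z t) (fun t => c * f t) :=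
  ⟨hz.1.const_mul c, fun t ht => by rw [rlIntegral_const_mul, hz.2 ht]⟩

theorem sum (h0 : 0 ≤ γ) (h1 : γ < 1) {ι : Type*} (s : Finset ι) {z f : ι → ℝ → ℝ}
    (h : ∀ i ∈ s, IsFracDerivOf γ T (z i) (f i)) :
    IsFracDerivOf γ T (fun t => ∑ i ∈ s, z i t) (fun t => ∑ i ∈ s, f i t) :=
  ⟨MemWeightedC.sum s fun i hi => (h i hi).1, fun t ht => by
    rw [rlIntegral_sum h0 h1 ht s fun i hi => (h i hi).1]
    exact Finset.sum_congr rfl fun i hi => (h i hi).2 ht⟩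

/-- The graph of D^γ is closed, since I^γ is bounded. Both z and f are approximated by the same
pair, and the factor C allows for the norm of a bilinear map. -/
theorem of_approx (h0 : 0 ≤ γ) (h1 : γ < 1) (hT : 0 < T) {C : ℝ} (hC : 0 ≤ C)
    (h : ∀ ε > 0, ∃ w g, IsFracDerivOf γ T w g ∧
      (∀ t ∈ Ioc 0 T, |z t - w t| ≤ C * ε * t ^ (-γ)) ∧ ∀ t ∈ Ioc 0 T, |f t - g t| ≤ C * ε) :
    IsFracDerivOf γ T z f := by
  have hz : MemWeightedC γ T z := by
    refine MemWeightedC.of_approx hT fun ε hε => ?_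
    obtain ⟨w, g, hw, hzw, -⟩ := h (ε / (C + 1)) (by positivity)
    refine ⟨w, hw.1, fun t ht => (hzw t ht).trans ?_⟩
    refine mul_le_mul_of_nonneg_right ?_ (Real.rpow_pos_of_pos ht.1 _).le
    rw [mul_div_assoc', div_le_iff₀ (by positivity)]
    nlinarith
  refine ⟨hz, fun t ht => ?_⟩
  rw [← sub_eq_zero]
  have hB := rlIntegralBound_nonneg h0 h1 hT
  have htp := (Real.rpow_pos_of_pos ht.1 (-γ)).le
  refine eq_zero_of_forall_abs_le_mul (C := C * rlIntegralBound γ γ T * t ^ (-γ) + C)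
    (by positivity) fun ε hε => ?_
  obtain ⟨w, g, hw, hzw, hfg⟩ := h ε hε
  have h2 := abs_rlIntegral_sub_le h0 h1 ht (by positivity) hz hw.1 hzw
  have h3 := hfg t ht
  rw [hw.2 ht] at h2
  rw [abs_le] at h2 h3 ⊢
  constructor <;> linarith [h2.1, h2.2, h3.1, h3.2]

end IsFracDerivOf

/-! ### Marchaud integrals and the Leibniz rule for powers. -/

/-- The integral in Marchaud's form of the fractional derivative of order `γ` of the product
`a * v`. -/
noncomputable def marchaud (γ : ℝ) (a v : ℝ → ℝ) (t : ℝ) : ℝ :=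
  ∫ s in (0 : ℝ)..t, v s * (a t - a s) * (t - s) ^ (-γ - 1)

/-- The increment of a supplies a factor t - s, which reduces the kernel (t-s)^(-γ-1) to the
integrable (t-s)^(-γ). The factor s^(-γ) allows for a derivative of a that is singular at 0. -/
theorem abs_marchaud_integrand_le {γ t A V : ℝ} {a v : ℝ → ℝ} (hV : 0 ≤ V)
    (ha : ∀ s ∈ Ioo 0 t, |a t - a s| ≤ A * s ^ (-γ) * (t - s)) (hv : ∀ s ∈ Ioo 0 t, |v s| ≤ V) :
    ∀ s ∈ Ioo 0 t, |v s * (a t - a s) * (t - s) ^ (-γ - 1)| ≤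
      V * A * (s ^ ((1 - γ) - 1) * (t - s) ^ ((1 - γ) - 1)) := by
  intro s hs
  have hts : 0 < t - s := sub_pos.2 hs.2
  have hp := Real.rpow_pos_of_pos hts (-γ - 1)
  rw [abs_mul, abs_mul, abs_of_pos hp]
  have e : (t - s) ^ ((1 - γ) - 1) = (t - s) * (t - s) ^ (-γ - 1) := by
    rw [show (1 - γ) - 1 = 1 + (-γ - 1) by ring, Real.rpow_add hts, Real.rpow_one]
  rw [e, show (1 - γ) - 1 = -γ by ring]
  calc |v s| * |a t - a s| * (t - s) ^ (-γ - 1) ≤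
      V * (A * s ^ (-γ) * (t - s)) * (t - s) ^ (-γ - 1) := by
        refine mul_le_mul_of_nonneg_right ?_ hp.le
        exact mul_le_mul (hv s hs) (ha s hs) (abs_nonneg _) hV
    _ = _ := by ring

theorem intervalIntegrable_marchaud {γ t A V : ℝ} {a v : ℝ → ℝ} (h1 : γ < 1) (ht : 0 < t)
    (hV : 0 ≤ V) (ha : ∀ s ∈ Ioo 0 t, |a t - a s| ≤ A * s ^ (-γ) * (t - s))
    (hv : ∀ s ∈ Ioo 0 t, |v s| ≤ V) (hac : ContinuousOn a (Ioo 0 t))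
    (hvc : ContinuousOn v (Ioo 0 t)) :
    IntervalIntegrable (fun s => v s * (a t - a s) * (t - s) ^ (-γ - 1)) volume 0 t := by
  refine intervalIntegrable_of_abs_le_rpow (sub_pos.2 h1) (sub_pos.2 h1) ht ?_
    (abs_marchaud_integrand_le hV ha hv)
  refine (hvc.mul (continuousOn_const.sub hac)).mul fun s hs => ?_
  exact ((continuousAt_const.sub continuousAt_id).rpow_const
      (Or.inl (sub_pos.2 hs.2).ne')).continuousWithinAt

theorem abs_marchaud_le {γ T t A V : ℝ} {a v : ℝ → ℝ} (h1 : γ < 1) (ht : t ∈ Ioc 0 T)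
    (hV : 0 ≤ V) (hA : 0 ≤ A) (ha : ∀ s ∈ Ioo 0 t, |a t - a s| ≤ A * s ^ (-γ) * (t - s))
    (hv : ∀ s ∈ Ioo 0 t, |v s| ≤ V) :
    |marchaud γ a v t| ≤ V * A * (beta (1 - γ) (1 - γ) * T ^ (1 - γ)) * t ^ (-γ) := by
  refine (abs_integral_le_rpow (sub_pos.2 h1) (sub_pos.2 h1) ht.1
    (abs_marchaud_integrand_le hV ha hv)).trans ?_
  have hb := beta_pos (sub_pos.2 h1) (sub_pos.2 h1)
  rw [show 1 - γ + (1 - γ) - 1 = (1 - γ) + -γ by ring, Real.rpow_add ht.1]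
  have h3 := Real.rpow_pos_of_pos ht.1 (-γ)
  have h4 : t ^ (1 - γ) ≤ T ^ (1 - γ) := Real.rpow_le_rpow ht.1.le ht.2 (sub_pos.2 h1).le
  calc _ = V * A * (beta (1 - γ) (1 - γ) * t ^ (1 - γ)) * t ^ (-γ) := by ring
    _ ≤ _ := by gcongr

theorem abs_rlIntegral_one_sub_le {γ T s t G : ℝ} (h0 : 0 ≤ γ) (h1 : γ < 1) {x : ℝ → ℝ}
    (hx : MemWeightedC γ T x) (hG : ∀ r ∈ Ioc 0 T, |x r| ≤ G * r ^ (-γ)) (hs : 0 < s)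
    (hst : s < t) (ht : t ≤ T) (hG0 : 0 ≤ G) :
    |rlIntegral 1 x t - rlIntegral 1 x s| ≤ G * s ^ (-γ) * (t - s) := by
  have hi : ∀ {t}, t ∈ Ioc 0 T → IntervalIntegrable x volume 0 t := fun ht => by
    simpa using hx.intervalIntegrable one_pos h1 ht
  rw [rlIntegral_one, rlIntegral_one, intervalIntegral.integral_interval_sub_left
    (hi ⟨hs.trans hst, ht⟩) (hi ⟨hs, hst.le.trans ht⟩), ← abs_of_pos (sub_pos.2 hst),
    ← Real.norm_eq_abs]
  refine intervalIntegral.norm_integral_le_of_norm_le_const fun r hr => ?_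
  rw [uIoc_of_le hst.le] at hr
  refine (hG r ⟨hs.trans hr.1, hr.2.trans ht⟩).trans ?_
  exact mul_le_mul_of_nonneg_left
    (Real.rpow_le_rpow_of_nonpos hs hr.1.le (neg_nonpos.2 h0)) hG0

/-- The condition on β says that t^β has its derivative in C_γ. In the mean value theorem c^(β-1) =
c^(β-1+γ) c^(-γ): the first factor is largest at t and the second at s. -/
theorem rpow_sub_rpow_le {γ β s t : ℝ} (hβ : β = 0 ∨ 1 - γ ≤ β) (h1 : γ < 1) (h0 : 0 ≤ γ)
    (hs : 0 < s) (hst : s < t) :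
    |t ^ β - s ^ β| ≤ β * t ^ (β - 1 + γ) * s ^ (-γ) * (t - s) := by
  rcases hβ with rfl | hβ
  · simp
  have hβ0 : 0 < β := by linarith
  obtain ⟨c, hc, h⟩ := exists_hasDerivAt_eq_slope (fun x : ℝ => x ^ β) (fun x => β * x ^ (β - 1)) hst
    (fun x hx => (Real.continuousAt_rpow_const x β (Or.inr hβ0.le)).continuousWithinAt)
    (fun x hx => Real.hasDerivAt_rpow_const (Or.inl (hs.trans hx.1).ne'))
  rw [eq_div_iff (sub_pos.2 hst).ne'] at h
  rw [← h, abs_mul, abs_of_pos (sub_pos.2 hst)]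
  refine mul_le_mul_of_nonneg_right ?_ (sub_pos.2 hst).le
  have hc0 : 0 < c := hs.trans hc.1
  rw [abs_of_pos (mul_pos hβ0 (Real.rpow_pos_of_pos hc0 _)), mul_assoc]
  refine mul_le_mul_of_nonneg_left ?_ hβ0.le
  rw [show β - 1 = (β - 1 + γ) + -γ by ring, Real.rpow_add hc0,
    show β - 1 + γ + -γ + γ = β - 1 + γ by ring]
  exact mul_le_mul (Real.rpow_le_rpow hc0.le hc.2.le (by linarith))
    (Real.rpow_le_rpow_of_nonpos hs hc.1.le (by linarith)) (Real.rpow_nonneg hc0.le _)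
    (Real.rpow_nonneg (hs.trans hst).le _)

theorem continuousOn_rpow_Ioo {β t : ℝ} : ContinuousOn (fun s : ℝ => s ^ β) (Ioo 0 t) := fun s hs =>
  (Real.continuousAt_rpow_const s β (Or.inl hs.1.ne')).continuousWithinAt

/-- Integration by parts turns the integral into a Beta integral. The right side is D^γ t^β minus
the boundary term t^(β-γ)/Γ(1-γ) of Marchaud's formula. -/
theorem integral_rpow_sub_rpow_mul {γ β t : ℝ} (h0 : 0 < γ) (h1 : γ < 1) (hβ : 1 - γ ≤ β)
    (ht : 0 < t) :
    γ / Real.Gamma (1 - γ) * marchaud γ (fun s => s ^ β) (fun _ => 1) t = t ^ (β - γ) *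
      (Real.Gamma (β + 1) / Real.Gamma (β + 1 - γ) - 1 / Real.Gamma (1 - γ)) := by
  have hβ0 : 0 < β := by linarith
  have hb : ∀ s ∈ Ioo 0 t, |t ^ β - s ^ β| ≤ β * t ^ (β - 1 + γ) * s ^ (-γ) * (t - s) :=
    fun s hs => rpow_sub_rpow_le (Or.inr hβ) h1 h0.le hs.1 hs.2
  have hint : IntervalIntegrable (fun s => (1 : ℝ) * (t ^ β - s ^ β) * (t - s) ^ (-γ - 1))
      volume 0 t :=
    intervalIntegrable_marchaud (a := fun s => s ^ β) (v := fun _ => 1) h1 ht zero_le_one hb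
      (by simp) continuousOn_rpow_Ioo continuousOn_const
  have hint2 : IntervalIntegrable (fun s => s ^ (β - 1) * (t - s) ^ ((1 - γ) - 1)) volume 0 t :=
    intervalIntegrable_rpow_mul_sub_rpow hβ0 (sub_pos.2 h1) ht
  have key := intervalIntegral.integral_eq_sub_of_hasDerivAt_of_le
    (f := fun s : ℝ => (t ^ β - s ^ β) * (t - s) ^ (-γ))
    (f' := fun s => γ * ((1 : ℝ) * (t ^ β - s ^ β) * (t - s) ^ (-γ - 1)) -
      β * (s ^ (β - 1) * (t - s) ^ ((1 - γ) - 1))) ht.le ?_ ?_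
    ((hint.const_mul γ).sub (hint2.const_mul β))
  · rw [intervalIntegral.integral_sub (hint.const_mul γ) (hint2.const_mul β),
      intervalIntegral.integral_const_mul, intervalIntegral.integral_const_mul,
      integral_rpow_mul_sub_rpow hβ0 (sub_pos.2 h1) ht, beta] at key
    simp only [sub_self, zero_mul, Real.zero_rpow hβ0.ne', sub_zero, zero_sub] at key
    rw [← Real.rpow_add ht, show β + (1 - γ) - 1 = β - γ by ring, ← sub_eq_add_neg β γ] at key
    have hG := (Real.Gamma_pos_of_pos (sub_pos.2 h1)).ne'
    have hG2 := (Real.Gamma_pos_of_pos (show 0 < β + 1 - γ by linarith)).ne'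
    rw [show β + (1 - γ) = β + 1 - γ by ring] at key
    rw [Real.Gamma_add_one hβ0.ne', div_mul_eq_mul_div, div_eq_iff hG]
    unfold marchaud
    rw [eq_add_of_sub_eq key]
    field_simp
    ring
  -- Continuity up to s = t, where (t-s)^(-γ) alone blows up: the product is O((t-s)^(1-γ)), and its
  -- value at t is 0 because the first factor vanishes.
  · intro s hs
    rcases hs.2.eq_or_lt with rfl | hst
    · rcases hs.1.eq_or_lt with h | h
      · exact absurd h ht.ne
      have e : ((s ^ β - s ^ β) * (s - s) ^ (-γ) : ℝ) = 0 := by simp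
      rw [ContinuousWithinAt, e]
      refine squeeze_zero_norm' (a := fun r => β * s ^ (β - 1 + γ) * r ^ (-γ) * (s - r) ^ (1 - γ))
        ?_ ?_
      · have : ∀ᶠ r in 𝓝[Icc 0 s] s, 0 < r := mem_nhdsWithin_of_mem_nhds (Ioi_mem_nhds h)
        filter_upwards [this, self_mem_nhdsWithin] with r hr hr2
        rcases hr2.2.eq_or_lt with rfl | hrs
        · simp [Real.zero_rpow (sub_pos.2 h1).ne']
        · have hp := sub_pos.2 hrs
          rw [Real.norm_eq_abs, abs_mul, abs_of_pos (Real.rpow_pos_of_pos hp _), sub_eq_add_neg 1 γ,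
            Real.rpow_add hp, Real.rpow_one, ← mul_assoc]
          exact mul_le_mul_of_nonneg_right (hb r ⟨hr, hrs⟩) (Real.rpow_nonneg hp.le _)
      · have hcont : ContinuousAt (fun r => β * s ^ (β - 1 + γ) * r ^ (-γ) * (s - r) ^ (1 - γ)) s :=
          (continuousAt_const.mul (Real.continuousAt_rpow_const s _ (Or.inl h.ne'))).mul
            ((continuousAt_const.sub continuousAt_id).rpow_const (Or.inr (sub_pos.2 h1).le))
        have := hcont.tendsto
        simp only [sub_self, Real.zero_rpow (sub_pos.2 h1).ne', mul_zero] at this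
        exact this.mono_left nhdsWithin_le_nhds
    · refine ContinuousAt.continuousWithinAt ?_
      exact (continuousAt_const.sub (Real.continuousAt_rpow_const s _ (Or.inr hβ0.le))).mul
        ((continuousAt_const.sub continuousAt_id).rpow_const (Or.inl (sub_pos.2 hst).ne'))
  · intro s hs
    have hd1 : HasDerivAt (fun s : ℝ => t ^ β - s ^ β) (-(β * s ^ (β - 1))) s :=
      (Real.hasDerivAt_rpow_const (Or.inl hs.1.ne')).const_sub _
    have hd2 : HasDerivAt (fun s : ℝ => (t - s) ^ (-γ)) (-1 * -γ * (t - s) ^ (-γ - 1)) s :=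
      ((hasDerivAt_id s).const_sub t).rpow_const (Or.inl (sub_pos.2 hs.2).ne')
    refine (hd1.mul hd2).congr_deriv ?_
    rw [show (1 - γ) - 1 = -γ by ring]
    ring

theorem intervalIntegrable_rpow_sub_rpow_mul {γ β t : ℝ} (h0 : 0 < γ) (h1 : γ < 1)
    (hβ : β = 0 ∨ 1 - γ ≤ β) (ht : 0 < t) :
    IntervalIntegrable (fun s => (1 : ℝ) * (t ^ β - s ^ β) * (t - s) ^ (-γ - 1)) volume 0 t :=
  intervalIntegrable_marchaud (a := fun s => s ^ β) (v := fun _ => 1) h1 ht zero_le_one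
    (fun _ hs => rpow_sub_rpow_le hβ h1 h0.le hs.1 hs.2)
    (by simp) continuousOn_rpow_Ioo continuousOn_const

theorem marchaud_natCast_rpow {γ t : ℝ} (h0 : 0 < γ) (h1 : γ < 1) (q : ℕ) (ht : 0 < t) :
    γ / Real.Gamma (1 - γ) * marchaud γ (fun s => s ^ (q : ℝ)) (fun _ => 1) t = t ^ ((q : ℝ) - γ) *
      (Real.Gamma (q + 1) / Real.Gamma (q + 1 - γ) - 1 / Real.Gamma (1 - γ)) := by
  rcases q.eq_zero_or_pos with rfl | hq
  · simp [marchaud]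
  · have : (1 : ℝ) ≤ q := by exact_mod_cast hq
    exact integral_rpow_sub_rpow_mul h0 h1 (by linarith) ht

theorem marchaud_rpow_rpow {γ b t : ℝ} (h0 : 0 < γ) (h1 : γ < 1) (hb : 1 - γ ≤ b) (q : ℕ)
    (ht : 0 < t) :
    γ / Real.Gamma (1 - γ) * marchaud γ (fun s => s ^ b) (fun s => s ^ (q : ℝ)) t =
      t ^ (q + b - γ) * (Real.Gamma (q + b + 1) / Real.Gamma (q + b + 1 - γ) -
        Real.Gamma (q + 1) / Real.Gamma (q + 1 - γ)) := by
  have hq : (0 : ℝ) ≤ q := q.cast_nonneg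
  have hq' : (q : ℝ) = 0 ∨ 1 - γ ≤ q := by
    rcases q.eq_zero_or_pos with rfl | hq
    · simp
    · right
      have : (1 : ℝ) ≤ q := by exact_mod_cast hq
      linarith
  -- s^q (t^b - s^b) = (t^(q+b) - s^(q+b)) - t^b (t^q - s^q) reduces the integral to the case v = 1.
  have e : marchaud γ (fun s => s ^ b) (fun s => s ^ (q : ℝ)) t =
      marchaud γ (fun s => s ^ (q + b)) (fun _ => 1) t -
        t ^ b * marchaud γ (fun s => s ^ (q : ℝ)) (fun _ => 1) t := by
    unfold marchaud
    rw [← intervalIntegral.integral_const_mul, ← intervalIntegral.integral_sub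
      (intervalIntegrable_rpow_sub_rpow_mul h0 h1 (Or.inr (by linarith)) ht)
      ((intervalIntegrable_rpow_sub_rpow_mul h0 h1 hq' ht).const_mul _)]
    refine integral_congr_Ioo ht.le fun s hs => ?_
    simp only
    rw [Real.rpow_add ht, Real.rpow_add hs.1]
    ring
  rw [e, mul_sub, integral_rpow_sub_rpow_mul h0 h1 (by linarith) ht, mul_left_comm,
    marchaud_natCast_rpow h0 h1 q ht, ← mul_assoc, ← Real.rpow_add ht,
    show b + ((q : ℝ) - γ) = q + b - γ by ring]
  ring

theorem isFracDerivOf_rpow {γ β : ℝ} (T : ℝ) (h0 : 0 ≤ γ) (h1 : γ < 1) (hβ : 0 ≤ β) :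
    IsFracDerivOf γ T (fun t => Real.Gamma (β + 1) / Real.Gamma (β + 1 - γ) * t ^ (β - γ))
      (fun t => t ^ β) := by
  refine ⟨(memWeightedC_rpow (by linarith)).const_mul _, fun t ht => ?_⟩
  rw [rlIntegral_const_mul]
  have := rlIntegral_rpow h0 (show 0 < β - γ + 1 by linarith) ht.1
  rw [show β - γ + 1 - 1 = β - γ by ring, show β - γ + 1 + γ - 1 = β by ring,
    show β - γ + 1 + γ = β + 1 by ring, show β - γ + 1 = β + 1 - γ by ring] at this
  rw [this]
  have := (Real.Gamma_pos_of_pos (show 0 < β + 1 by linarith)).ne'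
  have := (Real.Gamma_pos_of_pos (show 0 < β + 1 - γ by linarith)).ne'
  field_simp

/-- The fractional derivative of order `γ` of the product of `I^1 y` and `I^γ x`, in Marchaud's
form. -/
noncomputable def fracDerivMul (γ : ℝ) (y x : ℝ → ℝ) (t : ℝ) : ℝ :=
  rlIntegral 1 y t * x t +
    γ / Real.Gamma (1 - γ) * marchaud γ (rlIntegral 1 y) (rlIntegral γ x) t

/-- Here I^1 y and I^γ x are multiples of t^b and t^q with b = p + 1 - γ, so the claim is the
explicit formula for D^γ t^(q+b); the D^γ t^q part of the Marchaud term cancels against the first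
summand. -/
theorem isFracDerivOf_fracDerivMul_pow {γ : ℝ} (T : ℝ) (h0 : 0 < γ) (h1 : γ < 1) (p q : ℕ) :
    IsFracDerivOf γ T (fracDerivMul γ (fun s => s ^ (-γ) * s ^ p) (fun s => s ^ (-γ) * s ^ q))
      (fun t => rlIntegral 1 (fun s => s ^ (-γ) * s ^ p) t *
        rlIntegral γ (fun s => s ^ (-γ) * s ^ q) t) := by
  have hp : (0 : ℝ) ≤ p := p.cast_nonneg
  have hq : (0 : ℝ) ≤ q := q.cast_nonneg
  set b : ℝ := p + 1 - γ with hb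
  have hb0 : 0 < b := by linarith
  set ca := Real.Gamma b / Real.Gamma (b + 1) with hca
  set cv := Real.Gamma (q + 1 - γ) / Real.Gamma (q + 1) with hcv
  have ha : ∀ t, 0 < t → rlIntegral 1 (fun s => s ^ (-γ) * s ^ p) t = ca * t ^ b := fun t ht => by
    rw [rlIntegral_rpow_neg_mul_pow zero_le_one h1 ht, ← hb, ← hca]
    congr 2
    ring
  have hv : ∀ t, 0 < t → rlIntegral γ (fun s => s ^ (-γ) * s ^ q) t = cv * t ^ (q : ℝ) :=
    fun t ht => by
      rw [rlIntegral_rpow_neg_mul_pow h0.le h1 ht, hcv,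
        show (q : ℝ) + 1 - γ + γ - 1 = q by ring, show (q : ℝ) + 1 - γ + γ = q + 1 by ring]
  refine ((isFracDerivOf_rpow T h0.le h1 (show 0 ≤ q + b by linarith)).const_mul (ca * cv)).congr
    (fun t ht => ?_) (fun t ht => ?_)
  · have e : marchaud γ (rlIntegral 1 fun s => s ^ (-γ) * s ^ p)
        (rlIntegral γ fun s => s ^ (-γ) * s ^ q) t =
        ca * cv * marchaud γ (fun s => s ^ b) (fun s => s ^ (q : ℝ)) t := by
      unfold marchaud
      rw [← intervalIntegral.integral_const_mul]
      refine integral_congr_Ioo ht.1.le fun s hs => ?_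
      simp only
      rw [ha t ht.1, ha s hs.1, hv s hs.1]
      ring
    simp only [fracDerivMul]
    have hM := marchaud_rpow_rpow h0 h1 (show 1 - γ ≤ b by linarith) q ht.1
    have hr : cv * (Real.Gamma (q + 1) / Real.Gamma (q + 1 - γ)) = 1 := by
      have := (Real.Gamma_pos_of_pos (show 0 < (q : ℝ) + 1 by linarith)).ne'
      have := (Real.Gamma_pos_of_pos (show 0 < (q : ℝ) + 1 - γ by linarith)).ne'
      rw [hcv]
      field_simp
    have hpow : t ^ b * (t ^ (-γ) * t ^ q) = t ^ (q + b - γ) := by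
      rw [← Real.rpow_natCast t q, ← Real.rpow_add ht.1, ← Real.rpow_add ht.1,
        show b + (-γ + q) = q + b - γ by ring]
    rw [e, ha t ht.1]
    linear_combination ca * hpow + ca * cv * hM - ca * t ^ (q + b - γ) * hr
  · simp only
    rw [ha t ht.1, hv t ht.1, Real.rpow_add ht.1]
    ring

/-! ### Bilinearity and boundedness of `fracDerivMul`. -/

section bilinear

variable {γ T t : ℝ} {x x₁ x₂ y y₁ y₂ : ℝ → ℝ}

theorem abs_rlIntegral_self_le {X : ℝ} (h0 : 0 ≤ γ) (h1 : γ < 1) (ht : 0 < t)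
    (hx : ∀ s ∈ Ioc 0 t, |x s| ≤ X * s ^ (-γ)) :
    |rlIntegral γ x t| ≤ X * Real.Gamma (1 - γ) := by
  simpa using abs_rlIntegral_le h0 h1 ht hx

theorem intervalIntegrable_marchaud_rlIntegral (h0 : 0 ≤ γ) (h1 : γ < 1) (ht : t ∈ Ioc 0 T)
    (hy : MemWeightedC γ T y) (hx : MemWeightedC γ T x) :
    IntervalIntegrable (fun s => rlIntegral γ x s * (rlIntegral 1 y t - rlIntegral 1 y s) *
      (t - s) ^ (-γ - 1)) volume 0 t := by
  have hT := ht.1.trans_le ht.2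
  obtain ⟨X, hX0, hX⟩ := hx.exists_bound
  obtain ⟨G, hG0, hG⟩ := hy.exists_bound
  have hsub : Ioo 0 t ⊆ Ioc 0 T := fun s hs => ⟨hs.1, hs.2.le.trans ht.2⟩
  have hΓ := Real.Gamma_pos_of_pos (sub_pos.2 h1)
  exact intervalIntegrable_marchaud (V := X * Real.Gamma (1 - γ)) h1 ht.1 (by positivity)
    (fun s hs => abs_rlIntegral_one_sub_le h0 h1 hy hG hs.1 hs.2 ht.2 hG0)
    (fun s hs => abs_rlIntegral_self_le h0 h1 hs.1 fun r hr =>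
      hX r ⟨hr.1, hr.2.trans (hsub hs).2⟩)
    ((hy.rlIntegral zero_le_one h1 hT).continuousOn.mono hsub)
    ((hx.rlIntegral h0 h1 hT).continuousOn.mono hsub)

theorem fracDerivMul_add_left (h0 : 0 ≤ γ) (h1 : γ < 1) (ht : t ∈ Ioc 0 T)
    (hy₁ : MemWeightedC γ T y₁) (hy₂ : MemWeightedC γ T y₂) (hx : MemWeightedC γ T x) :
    fracDerivMul γ (fun s => y₁ s + y₂ s) x t = fracDerivMul γ y₁ x t + fracDerivMul γ y₂ x t := by
  have e : marchaud γ (rlIntegral 1 fun s => y₁ s + y₂ s) (rlIntegral γ x) t =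
      marchaud γ (rlIntegral 1 y₁) (rlIntegral γ x) t +
        marchaud γ (rlIntegral 1 y₂) (rlIntegral γ x) t := by
    unfold marchaud
    rw [← intervalIntegral.integral_add (intervalIntegrable_marchaud_rlIntegral h0 h1 ht hy₁ hx)
      (intervalIntegrable_marchaud_rlIntegral h0 h1 ht hy₂ hx)]
    refine integral_congr_Ioo ht.1.le fun s hs => ?_
    rw [rlIntegral_add zero_le_one h1 ht hy₁ hy₂,
      rlIntegral_add zero_le_one h1 ⟨hs.1, hs.2.le.trans ht.2⟩ hy₁ hy₂]
    ring
  simp only [fracDerivMul]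
  rw [e, rlIntegral_add zero_le_one h1 ht hy₁ hy₂]
  ring

theorem fracDerivMul_add_right (h0 : 0 ≤ γ) (h1 : γ < 1) (ht : t ∈ Ioc 0 T)
    (hy : MemWeightedC γ T y) (hx₁ : MemWeightedC γ T x₁) (hx₂ : MemWeightedC γ T x₂) :
    fracDerivMul γ y (fun s => x₁ s + x₂ s) t = fracDerivMul γ y x₁ t + fracDerivMul γ y x₂ t := by
  have e : marchaud γ (rlIntegral 1 y) (rlIntegral γ fun s => x₁ s + x₂ s) t =
      marchaud γ (rlIntegral 1 y) (rlIntegral γ x₁) t +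
        marchaud γ (rlIntegral 1 y) (rlIntegral γ x₂) t := by
    unfold marchaud
    rw [← intervalIntegral.integral_add (intervalIntegrable_marchaud_rlIntegral h0 h1 ht hy hx₁)
      (intervalIntegrable_marchaud_rlIntegral h0 h1 ht hy hx₂)]
    refine integral_congr_Ioo ht.1.le fun s hs => ?_
    rw [rlIntegral_add h0 h1 ⟨hs.1, hs.2.le.trans ht.2⟩ hx₁ hx₂]
    ring
  simp only [fracDerivMul]
  rw [e]
  ring

theorem fracDerivMul_const_mul_left (c : ℝ) :
    fracDerivMul γ (fun s => c * y s) x t = c * fracDerivMul γ y x t := by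
  have e : marchaud γ (rlIntegral 1 fun s => c * y s) (rlIntegral γ x) t =
      c * marchaud γ (rlIntegral 1 y) (rlIntegral γ x) t := by
    unfold marchaud
    rw [← intervalIntegral.integral_const_mul]
    simp_rw [rlIntegral_const_mul]
    congr 1
    funext s
    ring
  simp only [fracDerivMul]
  rw [e, rlIntegral_const_mul]
  ring

theorem fracDerivMul_const_mul_right (c : ℝ) :
    fracDerivMul γ y (fun s => c * x s) t = c * fracDerivMul γ y x t := by
  have e : marchaud γ (rlIntegral 1 y) (rlIntegral γ fun s => c * x s) t =
      c * marchaud γ (rlIntegral 1 y) (rlIntegral γ x) t := by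
    unfold marchaud
    rw [← intervalIntegral.integral_const_mul]
    simp_rw [rlIntegral_const_mul]
    congr 1
    funext s
    ring
  simp only [fracDerivMul]
  rw [e]
  ring

theorem fracDerivMul_sub_left (h0 : 0 ≤ γ) (h1 : γ < 1) (ht : t ∈ Ioc 0 T)
    (hy₁ : MemWeightedC γ T y₁) (hy₂ : MemWeightedC γ T y₂) (hx : MemWeightedC γ T x) :
    fracDerivMul γ (fun s => y₁ s - y₂ s) x t = fracDerivMul γ y₁ x t - fracDerivMul γ y₂ x t := by
  have h := fracDerivMul_add_left h0 h1 ht hy₁ (hy₂.const_mul (-1)) hx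
  rw [fracDerivMul_const_mul_left] at h
  rw [show (fun s => y₁ s - y₂ s) = fun s => y₁ s + -1 * y₂ s by funext s; ring, h]
  ring

theorem fracDerivMul_sub_right (h0 : 0 ≤ γ) (h1 : γ < 1) (ht : t ∈ Ioc 0 T)
    (hy : MemWeightedC γ T y) (hx₁ : MemWeightedC γ T x₁) (hx₂ : MemWeightedC γ T x₂) :
    fracDerivMul γ y (fun s => x₁ s - x₂ s) t = fracDerivMul γ y x₁ t - fracDerivMul γ y x₂ t := by
  have h := fracDerivMul_add_right h0 h1 ht hy hx₁ (hx₂.const_mul (-1))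
  rw [fracDerivMul_const_mul_right] at h
  rw [show (fun s => x₁ s - x₂ s) = fun s => x₁ s + -1 * x₂ s by funext s; ring, h]
  ring

theorem abs_rlIntegral_one_le (h1 : γ < 1) (ht : t ∈ Ioc 0 T) {G : ℝ} (hG0 : 0 ≤ G)
    (hy : ∀ s ∈ Ioc 0 T, |y s| ≤ G * s ^ (-γ)) :
    |rlIntegral 1 y t| ≤ G * (Real.Gamma (1 - γ) / Real.Gamma (1 - γ + 1) * T ^ (1 - γ)) := by
  have hΓ := Real.Gamma_pos_of_pos (sub_pos.2 h1)
  have hΓ' := Real.Gamma_pos_of_pos (show 0 < 1 - γ + 1 by linarith)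
  refine (abs_rlIntegral_le zero_le_one h1 ht.1
    fun s hs => hy s ⟨hs.1, hs.2.trans ht.2⟩).trans ?_
  rw [mul_assoc]
  have := Real.rpow_le_rpow ht.1.le ht.2 (sub_pos.2 h1).le
  gcongr

/-- A common bound of the bilinear maps `(y, x) ↦ fracDerivMul γ y x` and
`(y, x) ↦ I^1 y * I^γ x`. -/
theorem exists_fracDerivMul_bound (h0 : 0 ≤ γ) (h1 : γ < 1) (hT : 0 < T) :
    ∃ C, 0 ≤ C ∧ ∀ y x G X t, MemWeightedC γ T y → 0 ≤ G → 0 ≤ X → t ∈ Ioc 0 T →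
      (∀ s ∈ Ioc 0 T, |y s| ≤ G * s ^ (-γ)) → (∀ s ∈ Ioc 0 t, |x s| ≤ X * s ^ (-γ)) →
      |fracDerivMul γ y x t| ≤ C * G * X * t ^ (-γ) ∧
      |rlIntegral 1 y t * rlIntegral γ x t| ≤ C * G * X := by
  have hΓ := Real.Gamma_pos_of_pos (sub_pos.2 h1)
  have hΓ' := Real.Gamma_pos_of_pos (show 0 < 1 - γ + 1 by linarith)
  have hβ := beta_pos (sub_pos.2 h1) (sub_pos.2 h1)
  set A := Real.Gamma (1 - γ) / Real.Gamma (1 - γ + 1) * T ^ (1 - γ) with hA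
  have hA0 : 0 ≤ A := by positivity
  set B := γ / Real.Gamma (1 - γ) * (Real.Gamma (1 - γ) *
    (beta (1 - γ) (1 - γ) * T ^ (1 - γ))) with hB
  have hB0 : 0 ≤ B := by positivity
  -- A + B bounds the first map and A Γ(1-γ) the second; the sum serves both.
  refine ⟨A + B + A * Real.Gamma (1 - γ), by positivity,
    fun y x G X t hy hG0 hX0 ht hG hX => ?_⟩
  have hsub : ∀ s ∈ Ioo 0 t, |rlIntegral γ x s| ≤ X * Real.Gamma (1 - γ) := fun s hs =>
    abs_rlIntegral_self_le h0 h1 hs.1 fun r hr => hX r ⟨hr.1, hr.2.trans hs.2.le⟩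
  have e1 := abs_rlIntegral_one_le h1 ht hG0 hG
  have e2 := abs_rlIntegral_self_le h0 h1 ht.1 hX
  have e3 := hX t ⟨ht.1, le_rfl⟩
  have e4 := abs_marchaud_le (V := X * Real.Gamma (1 - γ)) h1 ht (by positivity) hG0
    (fun s hs => abs_rlIntegral_one_sub_le h0 h1 hy hG hs.1 hs.2 ht.2 hG0) hsub
  have htp := Real.rpow_pos_of_pos ht.1 (-γ)
  rw [← hA] at e1
  constructor
  · calc |fracDerivMul γ y x t| ≤ |rlIntegral 1 y t| * |x t| + γ / Real.Gamma (1 - γ) *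
          |marchaud γ (rlIntegral 1 y) (rlIntegral γ x) t| := by
          refine (abs_add_le _ _).trans ?_
          rw [abs_mul, abs_mul, abs_of_nonneg (div_nonneg h0 hΓ.le)]
      _ ≤ G * A * (X * t ^ (-γ)) + γ / Real.Gamma (1 - γ) * (X * Real.Gamma (1 - γ) * G *
          (beta (1 - γ) (1 - γ) * T ^ (1 - γ)) * t ^ (-γ)) := by gcongr
      _ = (A + B) * G * X * t ^ (-γ) := by rw [hB]; ring
      _ ≤ _ := by
          have : A + B ≤ A + B + A * Real.Gamma (1 - γ) := by linarith [mul_nonneg hA0 hΓ.le]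
          gcongr
  · rw [abs_mul]
    calc _ ≤ G * A * (X * Real.Gamma (1 - γ)) := by gcongr
      _ = (A * Real.Gamma (1 - γ)) * G * X := by ring
      _ ≤ _ := by
          have : A * Real.Gamma (1 - γ) ≤ A + B + A * Real.Gamma (1 - γ) := by linarith
          gcongr

end bilinear

/-! ### The Leibniz rule on C_γ and multiplication by functions in C^1_γ. -/

section

variable {γ T : ℝ}

/-- First half of a double density argument: y is a fixed power while x runs through C_γ. The second
half fixes x and lets y vary. -/
theorem isFracDerivOf_fracDerivMul_pow_left (h0 : 0 < γ) (h1 : γ < 1) (hT : 0 < T) (p : ℕ)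
    {ξ : ℝ → ℝ} (hξ : ContinuousOn ξ (Icc 0 T)) :
    IsFracDerivOf γ T (fracDerivMul γ (fun s => s ^ (-γ) * s ^ p) (fun s => s ^ (-γ) * ξ s))
      (fun t => rlIntegral 1 (fun s => s ^ (-γ) * s ^ p) t *
        rlIntegral γ (fun s => s ^ (-γ) * ξ s) t) := by
  have hp : MemWeightedC γ T (fun s => s ^ (-γ) * s ^ p) :=
    memWeightedC_rpow_neg_mul (continuousOn_pow p)
  refine continuousOn_Icc_induction (a := 0) (b := T) (P := fun ξ =>
    IsFracDerivOf γ T (fracDerivMul γ (fun s => s ^ (-γ) * s ^ p) (fun s => s ^ (-γ) * ξ s))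
      (fun t => rlIntegral 1 (fun s => s ^ (-γ) * s ^ p) t *
        rlIntegral γ (fun s => s ^ (-γ) * ξ s) t))
    (isFracDerivOf_fracDerivMul_pow T h0 h1 p) ?_ ?_ ?_ hξ
  · intro f g hf hg h2 h3
    have hf := memWeightedC_rpow_neg_mul (γ := γ) hf
    have hg := memWeightedC_rpow_neg_mul (γ := γ) hg
    refine (h2.add h0.le h1 h3).congr (fun t ht => ?_) fun t ht => ?_
    · simp_rw [mul_add]
      rw [fracDerivMul_add_right h0.le h1 ht hp hf hg]
    · simp_rw [mul_add]
      rw [rlIntegral_add h0.le h1 ht hf hg, mul_add]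
  · intro c f hf h2
    refine (h2.const_mul c).congr (fun t ht => ?_) fun t ht => ?_
    · simp_rw [mul_left_comm _ c]
      rw [fracDerivMul_const_mul_right]
    · simp_rw [mul_left_comm _ c]
      rw [rlIntegral_const_mul, mul_left_comm]
  · intro f hf h
    obtain ⟨C, hC0, hC⟩ := exists_fracDerivMul_bound h0.le h1 hT
    obtain ⟨G, hG0, hG⟩ := hp.exists_bound
    refine IsFracDerivOf.of_approx h0.le h1 hT (C := C * G) (by positivity) fun ε hε => ?_
    obtain ⟨g, hg, hPg, hfg⟩ := h ε hε
    have hf := memWeightedC_rpow_neg_mul (γ := γ) hf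
    have hg := memWeightedC_rpow_neg_mul (γ := γ) hg
    refine ⟨_, _, hPg, fun t ht => ?_, fun t ht => ?_⟩
    · rw [← fracDerivMul_sub_right h0.le h1 ht hp hf hg]
      exact (hC _ _ G ε t hp hG0 hε.le ht hG fun s hs =>
        abs_rpow_neg_mul_sub_le hfg s ⟨hs.1, hs.2.trans ht.2⟩).1
    · rw [← mul_sub, ← rlIntegral_sub h0.le h1 ht hf hg]
      exact (hC _ _ G ε t hp hG0 hε.le ht hG fun s hs =>
        abs_rpow_neg_mul_sub_le hfg s ⟨hs.1, hs.2.trans ht.2⟩).2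

theorem isFracDerivOf_fracDerivMul (h0 : 0 < γ) (h1 : γ < 1) (hT : 0 < T) {x y : ℝ → ℝ}
    (hy : MemWeightedC γ T y) (hx : MemWeightedC γ T x) :
    IsFracDerivOf γ T (fracDerivMul γ y x) (fun t => rlIntegral 1 y t * rlIntegral γ x t) := by
  obtain ⟨ξ, hξ, hxξ⟩ := hx.exists_eqOn
  obtain ⟨η, hη, hyη⟩ := hy.exists_eqOn
  have key : IsFracDerivOf γ T
      (fracDerivMul γ (fun s => s ^ (-γ) * η s) (fun s => s ^ (-γ) * ξ s))
      (fun t => rlIntegral 1 (fun s => s ^ (-γ) * η s) t *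
        rlIntegral γ (fun s => s ^ (-γ) * ξ s) t) := by
    have hX := memWeightedC_rpow_neg_mul (γ := γ) hξ
    refine continuousOn_Icc_induction (a := 0) (b := T) (P := fun η => IsFracDerivOf γ T
      (fracDerivMul γ (fun s => s ^ (-γ) * η s) (fun s => s ^ (-γ) * ξ s))
      (fun t => rlIntegral 1 (fun s => s ^ (-γ) * η s) t *
        rlIntegral γ (fun s => s ^ (-γ) * ξ s) t))
      (fun p => isFracDerivOf_fracDerivMul_pow_left h0 h1 hT p hξ) ?_ ?_ ?_ hη
    · intro f g hf hg h2 h3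
      have hf := memWeightedC_rpow_neg_mul (γ := γ) hf
      have hg := memWeightedC_rpow_neg_mul (γ := γ) hg
      refine (h2.add h0.le h1 h3).congr (fun t ht => ?_) fun t ht => ?_
      · simp_rw [mul_add]
        rw [fracDerivMul_add_left h0.le h1 ht hf hg hX]
      · simp_rw [mul_add]
        rw [rlIntegral_add zero_le_one h1 ht hf hg, add_mul]
    · intro c f hf h2
      refine (h2.const_mul c).congr (fun t ht => ?_) fun t ht => ?_
      · simp_rw [mul_left_comm _ c]
        rw [fracDerivMul_const_mul_left]
      · simp_rw [mul_left_comm _ c]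
        rw [rlIntegral_const_mul, mul_assoc]
    · intro f hf h
      obtain ⟨C, hC0, hC⟩ := exists_fracDerivMul_bound h0.le h1 hT
      obtain ⟨X, hX0, hXb⟩ := hX.exists_bound
      refine IsFracDerivOf.of_approx h0.le h1 hT (C := C * X) (by positivity) fun ε hε => ?_
      obtain ⟨g, hg, hPg, hfg⟩ := h ε hε
      have hf := memWeightedC_rpow_neg_mul (γ := γ) hf
      have hg := memWeightedC_rpow_neg_mul (γ := γ) hg
      refine ⟨_, _, hPg, fun t ht => ?_, fun t ht => ?_⟩
      · rw [← fracDerivMul_sub_left h0.le h1 ht hf hg hX, mul_right_comm C X ε]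
        exact (hC _ _ ε X t (hf.sub hg) hε.le hX0 ht (abs_rpow_neg_mul_sub_le hfg) fun s hs =>
          hXb s ⟨hs.1, hs.2.trans ht.2⟩).1
      · rw [← sub_mul, ← rlIntegral_sub zero_le_one h1 ht hf hg, mul_right_comm C X ε]
        exact (hC _ _ ε X t (hf.sub hg) hε.le hX0 ht (abs_rpow_neg_mul_sub_le hfg) fun s hs =>
          hXb s ⟨hs.1, hs.2.trans ht.2⟩).2
  refine key.congr (fun t ht => ?_) fun t ht => ?_
  · have e : marchaud γ (rlIntegral 1 y) (rlIntegral γ x) t =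
        marchaud γ (rlIntegral 1 fun s => s ^ (-γ) * η s)
          (rlIntegral γ fun s => s ^ (-γ) * ξ s) t := by
      unfold marchaud
      refine integral_congr_Ioo ht.1.le fun s hs => ?_
      have hs' : s ∈ Ioc 0 T := ⟨hs.1, hs.2.le.trans ht.2⟩
      rw [rlIntegral_eqOn hxξ hs', rlIntegral_eqOn hyη hs', rlIntegral_eqOn hyη ht]
    simp only [fracDerivMul]
    rw [e, rlIntegral_eqOn hyη ht, hxξ ht]
  · simp only
    rw [rlIntegral_eqOn hyη ht, rlIntegral_eqOn hxξ ht]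

/-- The fundamental theorem of calculus, valid although a' may blow up at 0, since t^(-γ) is
integrable. -/
theorem MemWeightedCn.eq_add_rlIntegral_one (h1 : γ < 1) {a : ℝ → ℝ} (ha : MemWeightedCn γ T 1 a) :
    ∃ y, MemWeightedC γ T y ∧ ∀ t ∈ Ioc 0 T, a t = a 0 + rlIntegral 1 y t := by
  obtain ⟨hc, hd, hy⟩ := ha
  refine ⟨_, hy, fun t ht => ?_⟩
  have hi := hy.intervalIntegrable one_pos h1 ht
  simp only [sub_self, Real.rpow_zero, one_mul] at hi
  rw [rlIntegral_one, intervalIntegral.integral_eq_sub_of_hasDerivAt_of_le ht.1.le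
    (hc.continuousOn.mono (Icc_subset_Icc_right ht.2)) ?_ hi]
  · ring
  · intro s hs
    have h := hd s ⟨hs.1, hs.2.le.trans ht.2⟩
    rw [iteratedDerivWithin_zero] at h
    rw [zero_add, iteratedDerivWithin_one]
    exact h.hasDerivWithinAt.hasDerivAt (Icc_mem_nhds hs.1 (hs.2.trans_le ht.2))

/-- Multiplication by `a ∈ C^1_γ[0,T]` preserves the range of `I^γ` on `C_γ[0,T]`, with bounds. -/
theorem exists_isFracDerivOf_mul (h0 : 0 ≤ γ) (h1 : γ < 1) (hT : 0 < T) {a : ℝ → ℝ}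
    (ha : MemWeightedCn γ T 1 a) :
    ∃ C, 0 ≤ C ∧ ∀ x, MemWeightedC γ T x →
      ∃ z, IsFracDerivOf γ T z (fun t => a t * rlIntegral γ x t) ∧
        ∀ t ∈ Ioc 0 T, ∀ X, 0 ≤ X → (∀ s ∈ Ioc 0 t, |x s| ≤ X * s ^ (-γ)) →
          |z t| ≤ C * X * t ^ (-γ) := by
  have hac := ha.1.continuousOn
  rcases h0.eq_or_lt with rfl | h0
  · obtain ⟨A, hA⟩ := isCompact_Icc.exists_bound_of_continuousOn hac
    refine ⟨max A 0, le_max_right _ _, fun x hx => ⟨fun t => a t * x t,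
      ⟨hx.continuousOn_mul hac, fun t ht => by rw [rlIntegral_zero, rlIntegral_zero]⟩,
      fun t ht X hX0 hX => ?_⟩⟩
    have e1 := (hA t (Ioc_subset_Icc_self ht)).trans (le_max_left A 0)
    have e2 := hX t ⟨ht.1, le_rfl⟩
    rw [abs_mul, mul_assoc]
    exact mul_le_mul e1 e2 (abs_nonneg _) (le_max_right _ _)
  · obtain ⟨y, hy, hay⟩ := ha.eq_add_rlIntegral_one h1
    obtain ⟨C, hC0, hC⟩ := exists_fracDerivMul_bound h0.le h1 hT
    obtain ⟨G, hG0, hG⟩ := hy.exists_bound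
    -- With a = a(0) + I^1 y, the constant part contributes a(0) x and the rest is the Leibniz rule.
    refine ⟨|a 0| + C * G, by positivity, fun x hx =>
      ⟨fun t => a 0 * x t + fracDerivMul γ y x t, ?_, fun t ht X hX0 hX => ?_⟩⟩
    · have hx' : IsFracDerivOf γ T x (rlIntegral γ x) := ⟨hx, fun _ _ => rfl⟩
      refine ((hx'.const_mul (a 0)).add h0.le h1
        (isFracDerivOf_fracDerivMul h0 h1 hT hy hx)).congr (fun _ _ => rfl) fun t ht => ?_
      simp only
      rw [hay t ht]
      ring
    · have e1 := (hC y x G X t hy hG0 hX0 ht hG hX).1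
      have e2 := hX t ⟨ht.1, le_rfl⟩
      calc _ ≤ |a 0| * |x t| + |fracDerivMul γ y x t| := by
            rw [← abs_mul]; exact abs_add_le _ _
        _ ≤ |a 0| * (X * t ^ (-γ)) + C * G * X * t ^ (-γ) := by gcongr
        _ = _ := by ring

end

/-! ### Derivatives of fractional integrals and Taylor's formula in C^n_γ. -/

theorem eqOn_iteratedDerivWithin_of_hasDerivWithinAt {S : Set ℝ} (hS : UniqueDiffOn ℝ S)
    {G : ℕ → ℝ → ℝ} {n : ℕ}
    (h : ∀ k < n, ∀ t ∈ S, HasDerivWithinAt (G k) (G (k + 1) t) S t) :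
    ∀ k ≤ n, EqOn (iteratedDerivWithin k (G 0) S) (G k) S := by
  intro k
  induction k with
  | zero => intro _ t _; rw [iteratedDerivWithin_zero]
  | succ k ih =>
    intro hk t ht
    rw [iteratedDerivWithin_succ, derivWithin_congr (ih (by omega)) (ih (by omega) ht)]
    exact (h k (by omega) t ht).derivWithin (hS t ht)

section

variable {γ T : ℝ}

theorem iteratedDerivWithin_Icc_succ (hT : 0 < T) {G : ℕ → ℝ → ℝ} {N : ℕ}
    (h : ∀ k < N, ∀ t ∈ Icc 0 T, HasDerivWithinAt (G k) (G (k + 1) t) (Icc 0 T) t)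
    (hN' : ∀ t ∈ Ioc 0 T, HasDerivWithinAt (G N) (G (N + 1) t) (Icc 0 T) t) :
    EqOn (iteratedDerivWithin (N + 1) (G 0) (Icc 0 T)) (G (N + 1)) (Ioc 0 T) := by
  intro t ht
  have e := eqOn_iteratedDerivWithin_of_hasDerivWithinAt (uniqueDiffOn_Icc hT) h N le_rfl
  rw [iteratedDerivWithin_succ, derivWithin_congr e (e (Ioc_subset_Icc_self ht))]
  exact (hN' t ht).derivWithin (uniqueDiffOn_Icc hT t (Ioc_subset_Icc_self ht))

theorem memWeightedCn_of_hasDerivWithinAt (hT : 0 < T) {G : ℕ → ℝ → ℝ} {N : ℕ}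
    (h : ∀ k < N, ∀ t ∈ Icc 0 T, HasDerivWithinAt (G k) (G (k + 1) t) (Icc 0 T) t)
    (hN : ContinuousOn (G N) (Icc 0 T))
    (hN' : ∀ t ∈ Ioc 0 T, HasDerivWithinAt (G N) (G (N + 1) t) (Icc 0 T) t)
    (hG : MemWeightedC γ T (G (N + 1))) : MemWeightedCn γ T (N + 1) (G 0) := by
  have e := eqOn_iteratedDerivWithin_of_hasDerivWithinAt (uniqueDiffOn_Icc hT) h
  refine ⟨?_, fun t ht => ?_, hG.congr (iteratedDerivWithin_Icc_succ hT h hN')⟩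
  · refine contDiffOn_of_continuousOn_differentiableOn_deriv (n := (N : ℕ∞)) ?_ ?_
    · intro m hm
      have hm : m ≤ N := by exact_mod_cast hm
      refine ContinuousOn.congr ?_ (e m hm)
      rcases hm.eq_or_lt with rfl | hm
      · exact hN
      · exact fun t ht => (h m hm t ht).continuousWithinAt
    · intro m hm
      have hm : m < N := by exact_mod_cast hm
      exact DifferentiableOn.congr (fun t ht => (h m hm t ht).differentiableWithinAt) (e m hm.le)
  · exact (hN' t ht).differentiableWithinAt.congr (e N le_rfl)
      (e N le_rfl (Ioc_subset_Icc_self ht))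

theorem rlIntegral_eq_integral {β : ℝ} (hβ : 1 ≤ β) (h1 : γ < 1) {f : ℝ → ℝ}
    (hf : MemWeightedC γ T f) :
    EqOn (rlIntegral β f) (fun t => ∫ s in (0 : ℝ)..t, rlIntegral (β - 1) f s) (Icc 0 T) := by
  intro t ht
  rcases ht.1.eq_or_lt with rfl | h
  · simp [rlIntegral_apply_zero (show β ≠ 0 by linarith)]
  · have := rlIntegral_rlIntegral zero_le_one (sub_nonneg.2 hβ) h1 hf ⟨h, ht.2⟩
    rw [rlIntegral_one] at this
    simp only
    rw [this, add_sub_cancel]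

/-- Only t = 0 is delicate; there |I^α f(t)| = O(t^(α-γ)) tends to 0, as α ≥ 1 > γ. -/
theorem continuousOn_rlIntegral {α : ℝ} (hα : 1 ≤ α) (h1 : γ < 1) (hT : 0 < T) {f : ℝ → ℝ}
    (hf : MemWeightedC γ T f) : ContinuousOn (rlIntegral α f) (Icc 0 T) := by
  have hα0 : 0 < α := by linarith
  intro t ht
  rcases ht.1.eq_or_lt with rfl | h
  · obtain ⟨X, hX0, hX⟩ := hf.exists_bound
    rw [ContinuousWithinAt, rlIntegral_apply_zero hα0.ne']
    set K := X * (Real.Gamma (1 - γ) / Real.Gamma (1 - γ + α))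
    have hp : 0 < α - γ := by linarith
    refine squeeze_zero_norm' (a := fun s => K * s ^ (α - γ)) ?_ ?_
    · filter_upwards [self_mem_nhdsWithin] with s hs
      rcases hs.1.eq_or_lt with rfl | h
      · simp [rlIntegral_apply_zero hα0.ne', Real.zero_rpow hp.ne']
      · exact abs_rlIntegral_le hα0.le h1 h fun r hr => hX r ⟨hr.1, hr.2.trans hs.2⟩
    · have : ContinuousAt (fun s : ℝ => K * s ^ (α - γ)) 0 :=
        continuousAt_const.mul (Real.continuousAt_rpow_const 0 _ (Or.inr hp.le))
      have h := this.tendsto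
      simp only [Real.zero_rpow hp.ne', mul_zero] at h
      exact h.mono_left nhdsWithin_le_nhds
  · have hc := (hf.rlIntegral hα0.le h1 hT).continuousOn t ⟨h, ht.2⟩
    have e : Ioc 0 T = Icc 0 T ∩ Ioi 0 := by ext; simp [and_assoc]; grind
    rw [e] at hc
    rwa [ContinuousWithinAt, nhdsWithin_inter_of_mem'
      (mem_nhdsWithin_of_mem_nhds (Ioi_mem_nhds h))] at hc

/-- For 1 ≤ β < 2 the derivative I^(β-1) f may be singular at 0, hence the restriction to t > 0. -/
theorem hasDerivWithinAt_rlIntegral {β t : ℝ} (hβ : 1 ≤ β) (h1 : γ < 1) {f : ℝ → ℝ}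
    (hf : MemWeightedC γ T f) (ht : t ∈ Ioc 0 T) :
    HasDerivWithinAt (rlIntegral β f) (rlIntegral (β - 1) f t) (Icc 0 T) t := by
  have hT := ht.1.trans_le ht.2
  have ht' := Ioc_subset_Icc_self ht
  have hM := hf.rlIntegral (sub_nonneg.2 hβ) h1 hT
  refine HasDerivWithinAt.congr ?_ (rlIntegral_eq_integral hβ h1 hf)
    (rlIntegral_eq_integral hβ h1 hf ht')
  have : Fact (t ∈ Icc 0 T) := ⟨ht'⟩
  have e : Ioc 0 T = Icc 0 T ∩ Ioi 0 := by ext; simp [and_assoc]; grind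
  have e2 : 𝓝[Ioc 0 T] t = 𝓝[Icc 0 T] t := by
    rw [e, nhdsWithin_inter_of_mem' (mem_nhdsWithin_of_mem_nhds (Ioi_mem_nhds ht.1))]
  refine intervalIntegral.integral_hasDerivWithinAt_right
    (by simpa using hM.intervalIntegrable one_pos h1 ht) (t := Icc 0 T) ?_ ?_
  · rw [← e2]
    exact hM.continuousOn.stronglyMeasurableAtFilter_nhdsWithin measurableSet_Ioc t
  · rw [ContinuousWithinAt, ← e2]
    exact hM.continuousOn t ht

/-- From β = 2 on, I^(β-1) f is continuous up to 0, so the endpoint can be included. -/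
theorem hasDerivWithinAt_rlIntegral_Icc {β t : ℝ} (hβ : 2 ≤ β) (h1 : γ < 1) (hT : 0 < T)
    {f : ℝ → ℝ} (hf : MemWeightedC γ T f) (ht : t ∈ Icc 0 T) :
    HasDerivWithinAt (rlIntegral β f) (rlIntegral (β - 1) f t) (Icc 0 T) t := by
  have hc := continuousOn_rlIntegral (show 1 ≤ β - 1 by linarith) h1 hT hf
  have hβ1 : 1 ≤ β := by linarith
  refine HasDerivWithinAt.congr ?_ (rlIntegral_eq_integral hβ1 h1 hf)
    (rlIntegral_eq_integral hβ1 h1 hf ht)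
  have : Fact (t ∈ Icc 0 T) := ⟨ht⟩
  refine intervalIntegral.integral_hasDerivWithinAt_right (t := Icc 0 T)
    (hc.mono ?_).intervalIntegrable
    (hc.stronglyMeasurableAtFilter_nhdsWithin measurableSet_Icc t) (hc t ht)
  rw [uIcc_of_le ht.1]
  exact Icc_subset_Icc_right ht.2

theorem eqOn_zero_of_hasDerivAt_zero {u : ℝ → ℝ} (hc : ContinuousOn u (Icc 0 T))
    (h : ∀ t ∈ Ioo 0 T, HasDerivAt u 0 t) (hu : u 0 = 0) : ∀ t ∈ Icc 0 T, u t = 0 := by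
  intro t ht
  rcases ht.1.eq_or_lt with rfl | h'
  · exact hu
  · obtain ⟨c, -, hc⟩ := exists_hasDerivAt_eq_slope u (fun _ => 0) h'
      (hc.mono (Icc_subset_Icc_right ht.2)) fun x hx => h x ⟨hx.1, hx.2.trans_le ht.2⟩
    rw [eq_comm, div_eq_zero_iff] at hc
    rcases hc with hc | hc <;> linarith

/-- The `k`-th derivative of `Φ_{j+1}`. -/
noncomputable def phiDeriv (j k : ℕ) (t : ℝ) : ℝ := if k ≤ j then phi (j - k) t else 0

theorem phiDeriv_zero (j : ℕ) : phiDeriv j 0 = phi j := by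
  funext t; simp [phiDeriv]

theorem phiDeriv_apply_zero (j k : ℕ) : phiDeriv j k 0 = if j = k then 1 else 0 := by
  unfold phiDeriv phi
  rcases lt_trichotomy j k with h | rfl | h
  · simp [h.not_ge, h.ne]
  · simp
  · rw [if_pos h.le, if_neg h.ne', zero_pow (by omega), zero_div]

theorem hasDerivAt_phiDeriv (j k : ℕ) (t : ℝ) :
    HasDerivAt (phiDeriv j k) (phiDeriv j (k + 1) t) t := by
  rcases lt_or_ge k j with h | h
  · obtain ⟨l, rfl⟩ := Nat.exists_eq_add_of_lt h
    have e : phiDeriv (k + l + 1) k = fun t => t ^ (l + 1) / ((l + 1).factorial : ℝ) := by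
      funext t
      rw [phiDeriv, if_pos (by omega), phi, show k + l + 1 - k = l + 1 by omega]
    have e2 : phiDeriv (k + l + 1) (k + 1) t = t ^ l / (l.factorial : ℝ) := by
      rw [phiDeriv, if_pos (by omega), phi, show k + l + 1 - (k + 1) = l by omega]
    rw [e, e2]
    refine ((hasDerivAt_pow (l + 1) t).div_const _).congr_deriv ?_
    rw [Nat.factorial_succ]
    push_cast
    have : (l.factorial : ℝ) ≠ 0 := by exact_mod_cast l.factorial_ne_zero
    field_simp
  · have e : phiDeriv j k = fun _ => if k ≤ j then (1 : ℝ) else 0 := by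
      funext t
      unfold phiDeriv phi
      split_ifs with h'
      · simp [le_antisymm h h']
      · rfl
    have e2 : phiDeriv j (k + 1) t = 0 := by rw [phiDeriv, if_neg (by omega)]
    rw [e, e2]
    exact hasDerivAt_const _ _

theorem rlIntegral_natCast_one (j : ℕ) {t : ℝ} (ht : 0 < t) :
    rlIntegral j (fun _ => 1) t = phi j t := by
  have := rlIntegral_rpow j.cast_nonneg one_pos ht
  simp only [sub_self, Real.rpow_zero, Real.Gamma_one] at this
  rw [this, phi, add_comm (1 : ℝ), Real.Gamma_nat_eq_factorial, add_sub_cancel_right,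
    Real.rpow_natCast]
  ring

/-- The derivatives of `Φ_{j+1} + I^n w`. -/
noncomputable def phiAddDeriv (n j : ℕ) (w : ℝ → ℝ) (k : ℕ) (t : ℝ) : ℝ :=
  phiDeriv j k t + rlIntegral ((n : ℝ) - k) w t

theorem phiAddDeriv_zero (n j : ℕ) (w : ℝ → ℝ) :
    phiAddDeriv n j w 0 = fun t => phi j t + rlIntegral n w t := by
  funext t
  simp [phiAddDeriv, phiDeriv_zero]

theorem hasDerivWithinAt_phiAddDeriv_Ioc (h1 : γ < 1) {w : ℝ → ℝ} (hw : MemWeightedC γ T w)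
    {n j k : ℕ} (hk : k + 1 ≤ n) {t : ℝ} (ht : t ∈ Ioc 0 T) :
    HasDerivWithinAt (phiAddDeriv n j w k) (phiAddDeriv n j w (k + 1) t) (Icc 0 T) t := by
  have hk : (k : ℝ) + 1 ≤ n := by exact_mod_cast hk
  refine HasDerivWithinAt.add (hasDerivAt_phiDeriv j k t).hasDerivWithinAt ?_
  have := hasDerivWithinAt_rlIntegral (β := (n : ℝ) - k) (by linarith) h1 hw ht
  rw [sub_sub] at this
  exact_mod_cast this

theorem hasDerivWithinAt_phiAddDeriv_Icc (h1 : γ < 1) (hT : 0 < T) {w : ℝ → ℝ}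
    (hw : MemWeightedC γ T w) {n j k : ℕ} (hk : k + 1 < n) {t : ℝ} (ht : t ∈ Icc 0 T) :
    HasDerivWithinAt (phiAddDeriv n j w k) (phiAddDeriv n j w (k + 1) t) (Icc 0 T) t := by
  have hk : (k : ℝ) + 1 + 1 ≤ n := by exact_mod_cast hk
  refine HasDerivWithinAt.add (hasDerivAt_phiDeriv j k t).hasDerivWithinAt ?_
  have := hasDerivWithinAt_rlIntegral_Icc (β := (n : ℝ) - k) (by linarith) h1 hT hw ht
  rw [sub_sub] at this
  exact_mod_cast this

theorem continuousOn_phiAddDeriv (h1 : γ < 1) (hT : 0 < T) {w : ℝ → ℝ}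
    (hw : MemWeightedC γ T w) {n j k : ℕ} (hk : k < n) :
    ContinuousOn (phiAddDeriv n j w k) (Icc 0 T) := by
  have hk : (k : ℝ) + 1 ≤ n := by exact_mod_cast hk
  refine ContinuousOn.add (fun t _ => (hasDerivAt_phiDeriv j k t).continuousAt.continuousWithinAt) ?_
  exact continuousOn_rlIntegral (by linarith) h1 hT hw

theorem iteratedDerivWithin_phi_add (h1 : γ < 1) (hT : 0 < T) {w : ℝ → ℝ}
    (hw : MemWeightedC γ T w) {n j k : ℕ} (hk : k < n) :
    EqOn (iteratedDerivWithin k (fun t => phi j t + rlIntegral n w t) (Icc 0 T))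
      (phiAddDeriv n j w k) (Icc 0 T) := by
  rw [← phiAddDeriv_zero]
  exact eqOn_iteratedDerivWithin_of_hasDerivWithinAt (uniqueDiffOn_Icc hT)
    (G := phiAddDeriv n j w) (n := n - 1)
    (fun l hl t ht => hasDerivWithinAt_phiAddDeriv_Icc h1 hT hw (by omega) ht) k (by omega)

theorem iteratedDerivWithin_phi_add_self (h1 : γ < 1) (hT : 0 < T) {w : ℝ → ℝ}
    (hw : MemWeightedC γ T w) {n j : ℕ} (hj : j < n) :
    EqOn (iteratedDerivWithin n (fun t => phi j t + rlIntegral n w t) (Icc 0 T)) w (Ioc 0 T) := by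
  obtain ⟨N, rfl⟩ : ∃ N, n = N + 1 := ⟨n - 1, by omega⟩
  rw [← phiAddDeriv_zero]
  intro t ht
  rw [iteratedDerivWithin_Icc_succ hT (G := phiAddDeriv (N + 1) j w)
    (fun l hl t ht => hasDerivWithinAt_phiAddDeriv_Icc h1 hT hw (by omega) ht)
    (fun t ht => hasDerivWithinAt_phiAddDeriv_Ioc h1 hw le_rfl ht) ht]
  simp [phiAddDeriv, phiDeriv, hj.not_ge, rlIntegral_zero]

theorem memWeightedCn_phi_add (h1 : γ < 1) (hT : 0 < T) {w : ℝ → ℝ}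
    (hw : MemWeightedC γ T w) {n j : ℕ} (hj : j < n) :
    MemWeightedCn γ T n (fun t => phi j t + rlIntegral n w t) := by
  obtain ⟨N, rfl⟩ : ∃ N, n = N + 1 := ⟨n - 1, by omega⟩
  rw [← phiAddDeriv_zero]
  refine memWeightedCn_of_hasDerivWithinAt hT (G := phiAddDeriv (N + 1) j w)
    (fun l hl t ht => hasDerivWithinAt_phiAddDeriv_Icc h1 hT hw (by omega) ht)
    (continuousOn_phiAddDeriv h1 hT hw (by omega))
    (fun t ht => hasDerivWithinAt_phiAddDeriv_Ioc h1 hw le_rfl ht) (hw.congr fun t _ => ?_)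
  simp [phiAddDeriv, phiDeriv, hj.not_ge, rlIntegral_zero]

theorem phiAddDeriv_apply_zero {n j k : ℕ} (hk : k < n) (w : ℝ → ℝ) :
    phiAddDeriv n j w k 0 = if j = k then 1 else 0 := by
  have hk : (k : ℝ) < n := by exact_mod_cast hk
  rw [phiAddDeriv, phiDeriv_apply_zero, rlIntegral_apply_zero (sub_pos.2 hk).ne', add_zero]

/-- Taylor's formula in `C^n_γ[0,T]` for functions with the initial values of `Φ_{j+1}`. -/
theorem MemWeightedCn.eqOn_phi_add (h1 : γ < 1) (hT : 0 < T) {n j : ℕ} (hj : j < n) {y : ℝ → ℝ}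
    (hy : MemWeightedCn γ T n y)
    (h0 : ∀ k < n, iteratedDerivWithin k y (Icc 0 T) 0 = if j = k then 1 else 0) :
    MemWeightedC γ T (iteratedDerivWithin n y (Icc 0 T)) ∧
      EqOn y (fun t => phi j t + rlIntegral n (iteratedDerivWithin n y (Icc 0 T)) t) (Icc 0 T) := by
  obtain ⟨N, rfl⟩ : ∃ N, n = N + 1 := ⟨n - 1, by omega⟩
  obtain ⟨hc, hd, hw⟩ := hy
  refine ⟨hw, ?_⟩
  set w := iteratedDerivWithin (N + 1) y (Icc 0 T) with hwdef
  have hu := uniqueDiffOn_Icc hT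
  have hder : ∀ k ≤ N, ∀ t ∈ Ioc 0 T, HasDerivWithinAt (iteratedDerivWithin k y (Icc 0 T))
      (iteratedDerivWithin (k + 1) y (Icc 0 T) t) (Icc 0 T) t := by
    intro k hk t ht
    rw [iteratedDerivWithin_succ]
    refine DifferentiableWithinAt.hasDerivWithinAt ?_
    rcases hk.eq_or_lt with rfl | hk
    · exact hd t ht
    · exact hc.differentiableOn_iteratedDerivWithin (by exact_mod_cast hk) hu t
        (Ioc_subset_Icc_self ht)
  -- Descending induction on the order N + 1 - l: once the derivatives of order k + 1 agree, those
  -- of order k differ by a constant, which is 0 by the initial values.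
  have key : ∀ l ≤ N + 1, ∀ t ∈ Ioc 0 T,
      iteratedDerivWithin (N + 1 - l) y (Icc 0 T) t = phiAddDeriv (N + 1) j w (N + 1 - l) t := by
    intro l
    induction l with
    | zero =>
      intro _ t _
      simp [phiAddDeriv, phiDeriv, hj.not_ge, rlIntegral_zero, hwdef]
    | succ l ih =>
      intro hl t ht
      have e : N + 1 - l = (N + 1 - (l + 1)) + 1 := by omega
      have ih := ih (by omega)
      rw [e] at ih
      set k := N + 1 - (l + 1) with hk
      rw [← sub_eq_zero]
      refine eqOn_zero_of_hasDerivAt_zero (u := fun t => iteratedDerivWithin k y (Icc 0 T) t -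
        phiAddDeriv (N + 1) j w k t) ?_ ?_ ?_ t (Ioc_subset_Icc_self ht)
      · refine ContinuousOn.sub ?_ (continuousOn_phiAddDeriv h1 hT hw (by omega))
        exact hc.continuousOn_iteratedDerivWithin (by exact_mod_cast (by omega : k ≤ N)) hu
      · intro s hs
        have hs' := Ioo_subset_Ioc_self hs
        have := (hder k (by omega) s hs').sub
          (hasDerivWithinAt_phiAddDeriv_Ioc (j := j) h1 hw (n := N + 1) (k := k) (by omega) hs')
        rw [ih s hs', sub_self] at this
        exact this.hasDerivAt (Icc_mem_nhds hs.1 hs.2)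
      · rw [h0 k (by omega), phiAddDeriv_apply_zero (by omega), sub_self]
  intro t ht
  rcases ht.1.eq_or_lt with rfl | ht0
  · have := h0 0 (by omega)
    rw [iteratedDerivWithin_zero, ← phiAddDeriv_apply_zero (n := N + 1) (by omega) w,
      phiAddDeriv_zero] at this
    exact this
  · have := key (N + 1) le_rfl t ⟨ht0, ht.2⟩
    rwa [Nat.sub_self, iteratedDerivWithin_zero, phiAddDeriv_zero] at this

/-! ### Riemann–Liouville and Caputo derivatives of Φ_{j+1} + I^n w. -/

/-- By the semigroup law I^(p-α) f = I^(ν+p-α) x, and each of the p differentiations lowers the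
order by one. The orders being differentiated stay at least ν - α + 1 ≥ 1. -/
theorem rlDeriv_rlIntegral (h1 : γ < 1) {α ν : ℝ} (hα : 0 ≤ α) (hν : α ≤ ν) {x f : ℝ → ℝ}
    (hx : MemWeightedC γ T x) (hf : EqOn f (rlIntegral ν x) (Ioc 0 T)) :
    HasRLDeriv α T f ∧ EqOn (rlDeriv α T f) (rlIntegral (ν - α) x) (Ioc 0 T) := by
  set p := ⌈α⌉₊ with hp
  have hpα : α ≤ p := Nat.le_ceil α
  set H : ℕ → ℝ → ℝ := fun k => rlIntegral (ν + p - α - k) x with hH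
  have hbase : EqOn (rlIntegral (p - α) f) (H 0) (Ioc 0 T) := by
    intro t ht
    rw [rlIntegral_eqOn hf ht, rlIntegral_rlIntegral (sub_nonneg.2 hpα) (hα.trans hν) h1 hx ht, hH]
    simp only [Nat.cast_zero]
    congr 1
    ring
  have hchain : ∀ k < p, ∀ t ∈ Ioc 0 T, HasDerivWithinAt (H k) (H (k + 1) t) (Ioc 0 T) t := by
    intro k hk t ht
    have hk : (k : ℝ) + 1 ≤ p := by exact_mod_cast hk
    have := (hasDerivWithinAt_rlIntegral (β := ν + p - α - k) (by linarith) h1 hx ht).mono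
      Ioc_subset_Icc_self
    rw [sub_sub _ (k : ℝ) 1] at this
    exact_mod_cast this
  have hit : ∀ k ≤ p, EqOn (iteratedDerivWithin k (rlIntegral (p - α) f) (Ioc 0 T)) (H k)
      (Ioc 0 T) := fun k hk t ht => by
    rw [iteratedDerivWithin_congr hbase ht,
      eqOn_iteratedDerivWithin_of_hasDerivWithinAt (uniqueDiffOn_Ioc 0 T) hchain k hk ht]
  constructor
  · intro k hk
    refine DifferentiableOn.mono ?_ Ioo_subset_Ioc_self
    exact DifferentiableOn.congr (fun t ht => (hchain k hk t ht).differentiableWithinAt)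
      (hit k hk.le)
  · intro t ht
    rw [rlDeriv, hit p le_rfl ht, hH]
    simp only
    congr 1
    ring

theorem phiFrac_eqOn (T : ℝ) {α : ℝ} {j : ℕ} (hα : 0 ≤ α) (hj : α ≤ j) :
    EqOn (phiFrac j α T) (rlIntegral (j - α) fun _ => 1) (Ioc 0 T) :=
  (rlDeriv_rlIntegral zero_lt_one hα hj (continuousOn_const.memWeightedC le_rfl)
    fun _ ht => (rlIntegral_natCast_one j ht.1).symm).2

/-- The Taylor polynomial of degree ⌈α⌉ - 1 at 0 contains Φ_{j+1} if j < ⌈α⌉ and is zero otherwise;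
this decides whether the term with Φ survives. -/
theorem caputoDeriv_of_eqOn_phi_add (h0 : 0 ≤ γ) (h1 : γ < 1) (hT : 0 < T) {α : ℝ} (hα : 0 ≤ α)
    {n j : ℕ} (hj : j < n) (hn : ⌈α⌉₊ ≤ n) {y w : ℝ → ℝ} (hw : MemWeightedC γ T w)
    (hy : EqOn y (fun t => phi j t + rlIntegral n w t) (Icc 0 T)) :
    HasCaputoDeriv α T y ∧ ∀ t ∈ Ioc 0 T, caputoDeriv α T y t =
      (if ⌈α⌉₊ ≤ j then phiFrac j α T t else 0) + rlIntegral (n - α) w t := by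
  have hnR : α ≤ n := (Nat.le_ceil α).trans (by exact_mod_cast hn)
  have hsub : ∀ t ∈ Ioc 0 T, subTaylor ⌈α⌉₊ T y t =
      (if ⌈α⌉₊ ≤ j then phi j t else 0) + rlIntegral n w t := by
    intro t ht
    have hd : ∀ k ∈ Finset.range ⌈α⌉₊, iteratedDerivWithin k y (Icc 0 T) 0 / (k.factorial : ℝ) *
        t ^ k = if j = k then phi j t else 0 := by
      intro k hk
      have hk := (Finset.mem_range.1 hk).trans_le hn
      have h0T : (0 : ℝ) ∈ Icc 0 T := left_mem_Icc.2 hT.le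
      rw [iteratedDerivWithin_congr hy h0T, iteratedDerivWithin_phi_add h1 hT hw hk h0T,
        phiAddDeriv_apply_zero hk]
      split_ifs with h
      · subst h; rw [phi]; ring
      · simp
    rw [subTaylor, Finset.sum_congr rfl hd, Finset.sum_ite_eq, hy (Ioc_subset_Icc_self ht)]
    simp only [Finset.mem_range]
    by_cases h : ⌈α⌉₊ ≤ j
    · rw [if_neg (not_lt.2 h), if_pos h, sub_zero]
    · rw [if_pos (not_le.1 h), if_neg h]; ring
  by_cases h : ⌈α⌉₊ ≤ j
  · have hαj : α ≤ j := (Nat.le_ceil α).trans (by exact_mod_cast h)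
    have hjn : (j : ℝ) ≤ n := by exact_mod_cast hj.le
    -- Φ_{j+1} + I^n w = I^j (1 + I^(n-j) w), so one application of D^α I^j = I^(j-α) handles both
    -- terms.
    have hone : MemWeightedC γ T (fun _ => (1 : ℝ)) := continuousOn_const.memWeightedC h0
    have hI := hw.rlIntegral (sub_nonneg.2 hjn) h1 hT
    obtain ⟨e1, e2⟩ := rlDeriv_rlIntegral h1 hα hαj (hone.add hI) (f := subTaylor ⌈α⌉₊ T y)
      fun t ht => by
        rw [hsub t ht, if_pos h, rlIntegral_add j.cast_nonneg h1 ht hone hI,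
          rlIntegral_natCast_one j ht.1,
          rlIntegral_rlIntegral j.cast_nonneg (sub_nonneg.2 hjn) h1 hw ht, add_sub_cancel]
    refine ⟨e1, fun t ht => ?_⟩
    rw [caputoDeriv, e2 ht, if_pos h, phiFrac_eqOn T hα hαj ht,
      rlIntegral_add (sub_nonneg.2 hαj) h1 ht hone hI,
      rlIntegral_rlIntegral (sub_nonneg.2 hαj) (sub_nonneg.2 hjn) h1 hw ht]
    congr 2
    ring
  · obtain ⟨e1, e2⟩ := rlDeriv_rlIntegral h1 hα hnR hw (f := subTaylor ⌈α⌉₊ T y)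
      fun t ht => by rw [hsub t ht, if_neg h, zero_add]
    refine ⟨e1, fun t ht => ?_⟩
    rw [caputoDeriv, e2 ht, if_neg h, zero_add]

end

/-! ### Exponential weights and the lifted Neumann series. -/

/-- Used with u = l(t-s): exponential decay yields the small factor l^(-η) at the price of a
slightly stronger singularity (t-s)^(-η). -/
theorem exp_neg_le_rpow_neg {η u : ℝ} (h0 : 0 ≤ η) (h1 : η ≤ 1) (hu : 0 < u) :
    Real.exp (-u) ≤ u ^ (-η) := by
  rw [Real.rpow_def_of_pos hu, Real.exp_le_exp]
  have := Real.log_le_sub_one_of_pos hu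
  nlinarith

section

variable {γ T : ℝ}

/-- Fractional integrals are contractions for exponentially weighted norms with large
parameter. -/
theorem eventually_abs_rlIntegral_le (h1 : γ < 1) (hT : 0 < T) {δ ε : ℝ} (hδ : 0 < δ) (hε : 0 < ε) :
    ∀ᶠ l in atTop, ∀ (f : ℝ → ℝ) (X t : ℝ), 0 ≤ X → t ∈ Ioc 0 T →
      (∀ s ∈ Ioo 0 t, |f s| ≤ X * Real.exp (l * s) * s ^ (-γ)) →
      |rlIntegral δ f t| ≤ ε * X * Real.exp (l * t) * t ^ (-γ) := by
  -- η < δ keeps the kernel (t-s)^(δ-η-1) integrable, and η ≤ 1 is needed for the exponential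
  -- estimate.
  set η := min δ 1 / 2 with hη
  have hη0 : 0 < η := by have := lt_min hδ one_pos; positivity
  have hη1 : η ≤ 1 := by have := min_le_right δ 1; linarith
  have hηδ : 0 < δ - η := by have := min_le_left δ 1; linarith
  have hΓ := Real.Gamma_pos_of_pos hδ
  have hβ := beta_pos (sub_pos.2 h1) hηδ
  set K := 1 / Real.Gamma δ * beta (1 - γ) (δ - η) * T ^ (δ - η) with hK
  have hK0 : 0 < K := by positivity
  have hlim : Tendsto (fun l : ℝ => K * l ^ (-η)) atTop (𝓝 0) := by
    simpa using (tendsto_rpow_neg_atTop hη0).const_mul K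
  filter_upwards [hlim.eventually_le_const hε, eventually_gt_atTop 0] with l hl hl0 f X t hX ht hf
  have hl' := Real.rpow_pos_of_pos hl0 (-η)
  have key := abs_integral_le_rpow (f := fun s => (t - s) ^ (δ - 1) * f s)
    (C := X * Real.exp (l * t) * l ^ (-η)) (sub_pos.2 h1) hηδ ht.1 (by
      intro s hs
      have hts := sub_pos.2 hs.2
      have hp := Real.rpow_pos_of_pos hts (δ - 1)
      have hs' := Real.rpow_pos_of_pos hs.1 (-γ)
      have e : Real.exp (l * s) ≤ Real.exp (l * t) * (l ^ (-η) * (t - s) ^ (-η)) := by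
        rw [← Real.mul_rpow hl0.le hts.le, show l * s = l * t + -(l * (t - s)) by ring,
          Real.exp_add]
        exact mul_le_mul_of_nonneg_left (exp_neg_le_rpow_neg hη0.le hη1 (mul_pos hl0 hts))
          (Real.exp_pos _).le
      rw [abs_mul, abs_of_pos hp, show 1 - γ - 1 = -γ by ring,
        show δ - η - 1 = (δ - 1) + -η by ring, Real.rpow_add hts]
      calc (t - s) ^ (δ - 1) * |f s| ≤ (t - s) ^ (δ - 1) * (X *
            (Real.exp (l * t) * (l ^ (-η) * (t - s) ^ (-η))) * s ^ (-γ)) := by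
            refine mul_le_mul_of_nonneg_left ((hf s hs).trans ?_) hp.le
            gcongr
        _ = _ := by ring)
  rw [rlIntegral_of_ne hδ.ne', abs_mul, abs_of_pos (by positivity)]
  have htT : t ^ (δ - η) ≤ T ^ (δ - η) := Real.rpow_le_rpow ht.1.le ht.2 hηδ.le
  have htp := Real.rpow_pos_of_pos ht.1 (-γ)
  have hexp := Real.exp_pos (l * t)
  rw [show 1 - γ + (δ - η) - 1 = (δ - η) + -γ by ring, Real.rpow_add ht.1] at key
  calc _ ≤ 1 / Real.Gamma δ * (X * Real.exp (l * t) * l ^ (-η) *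
        (beta (1 - γ) (δ - η) * (T ^ (δ - η) * t ^ (-γ)))) := by
        refine mul_le_mul_of_nonneg_left (key.trans ?_) (by positivity)
        gcongr
    _ = (K * l ^ (-η)) * X * Real.exp (l * t) * t ^ (-γ) := by rw [hK]; ring
    _ ≤ _ := by gcongr

theorem neumannOp_eqOn {m : ℕ} {α : ℕ → ℝ} {a : ℕ → ℝ → ℝ} {f g : ℝ → ℝ}
    (h : EqOn f g (Ioc 0 T)) : EqOn (neumannOp m α a f) (neumannOp m α a g) (Ioc 0 T) :=
  fun _ ht => Finset.sum_congr rfl fun _ _ => by rw [rlIntegral_eqOn h ht]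

theorem neumannOp_rlIntegral {m : ℕ} {α : ℕ → ℝ} (a : ℕ → ℝ → ℝ) (h0 : 0 ≤ γ) (h1 : γ < 1)
    (hα : ∀ i, 1 ≤ i → i ≤ m → α i < α 0) {w : ℝ → ℝ} (hw : MemWeightedC γ T w) :
    EqOn (neumannOp m α a (rlIntegral γ w))
      (fun t => ∑ i ∈ Finset.Icc 1 m, a i t * rlIntegral (α 0 - α i + γ) w t) (Ioc 0 T) := by
  refine fun t ht => Finset.sum_congr rfl fun i hi => ?_
  obtain ⟨hi1, hi2⟩ := Finset.mem_Icc.1 hi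
  rw [rlIntegral_rlIntegral (sub_pos.2 (hα i hi1 hi2)).le h0 h1 hw ht]

/-- Since a_i I^(α₀-α_i) I^γ w = a_i I^γ (I^(α₀-α_i) w), the multiplication lemma gives a
γ-derivative at the cost of a constant C_i, while I^(α₀-α_i) gains an arbitrarily small factor for
large l. -/
theorem exists_isFracDerivOf_neumannOp {m : ℕ} {α : ℕ → ℝ} {a : ℕ → ℝ → ℝ} (h0 : 0 ≤ γ)
    (h1 : γ < 1) (hT : 0 < T) (hα : ∀ i, 1 ≤ i → i ≤ m → α i < α 0)
    (ha : ∀ i, 1 ≤ i → i ≤ m → MemWeightedCn γ T 1 (a i)) :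
    ∃ l, 0 ≤ l ∧ ∀ w, MemWeightedC γ T w →
      ∃ w', IsFracDerivOf γ T w' (neumannOp m α a (rlIntegral γ w)) ∧ ∀ X, 0 ≤ X →
        (∀ s ∈ Ioc 0 T, |w s| ≤ X * Real.exp (l * s) * s ^ (-γ)) →
        ∀ t ∈ Ioc 0 T, |w' t| ≤ X / 2 * Real.exp (l * t) * t ^ (-γ) := by
  have hC : ∀ i, ∃ C, 0 ≤ C ∧ (i ∈ Finset.Icc 1 m → ∀ x, MemWeightedC γ T x →
      ∃ z, IsFracDerivOf γ T z (fun t => a i t * rlIntegral γ x t) ∧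
        ∀ t ∈ Ioc 0 T, ∀ X, 0 ≤ X → (∀ s ∈ Ioc 0 t, |x s| ≤ X * s ^ (-γ)) →
          |z t| ≤ C * X * t ^ (-γ)) := by
    intro i
    by_cases hi : i ∈ Finset.Icc 1 m
    · obtain ⟨hi1, hi2⟩ := Finset.mem_Icc.1 hi
      obtain ⟨C, hC0, hC⟩ := exists_isFracDerivOf_mul h0 h1 hT (ha i hi1 hi2)
      exact ⟨C, hC0, fun _ => hC⟩
    · exact ⟨0, le_rfl, fun h => absurd h hi⟩
  choose C hC0 hC using hC
  have hS : 0 ≤ ∑ i ∈ Finset.Icc 1 m, C i := Finset.sum_nonneg fun i _ => hC0 i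
  set ε := 1 / (2 * (∑ i ∈ Finset.Icc 1 m, C i + 1)) with hε
  have hε0 : 0 < ε := by positivity
  have hev : ∀ᶠ l in atTop, ∀ i ∈ Finset.Icc 1 m, ∀ (f : ℝ → ℝ) (X t : ℝ), 0 ≤ X →
      t ∈ Ioc 0 T → (∀ s ∈ Ioo 0 t, |f s| ≤ X * Real.exp (l * s) * s ^ (-γ)) →
      |rlIntegral (α 0 - α i) f t| ≤ ε * X * Real.exp (l * t) * t ^ (-γ) := by
    rw [Filter.eventually_all_finset]
    intro i hi
    obtain ⟨hi1, hi2⟩ := Finset.mem_Icc.1 hi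
    exact eventually_abs_rlIntegral_le h1 hT (sub_pos.2 (hα i hi1 hi2)) hε0
  obtain ⟨l, hl, hl0⟩ := (hev.and (eventually_ge_atTop 0)).exists
  refine ⟨l, hl0, fun w hw => ?_⟩
  have hM : ∀ i ∈ Finset.Icc 1 m, MemWeightedC γ T (rlIntegral (α 0 - α i) w) := fun i hi => by
    obtain ⟨hi1, hi2⟩ := Finset.mem_Icc.1 hi
    exact hw.rlIntegral (sub_pos.2 (hα i hi1 hi2)).le h1 hT
  have hz : ∀ i, ∃ z, i ∈ Finset.Icc 1 m → IsFracDerivOf γ T z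
      (fun t => a i t * rlIntegral γ (rlIntegral (α 0 - α i) w) t) ∧
        ∀ t ∈ Ioc 0 T, ∀ X, 0 ≤ X → (∀ s ∈ Ioc 0 t, |rlIntegral (α 0 - α i) w s| ≤ X * s ^ (-γ)) →
          |z t| ≤ C i * X * t ^ (-γ) := by
    intro i
    by_cases hi : i ∈ Finset.Icc 1 m
    · obtain ⟨z, hz⟩ := hC i hi _ (hM i hi)
      exact ⟨z, fun _ => hz⟩
    · exact ⟨0, fun h => absurd h hi⟩
  choose z hz using hz
  refine ⟨fun t => ∑ i ∈ Finset.Icc 1 m, z i t, ?_, fun X hX hwX t ht => ?_⟩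
  · refine (IsFracDerivOf.sum h0 h1 _ fun i hi => (hz i hi).1).congr (fun _ _ => rfl) fun t ht => ?_
    refine Finset.sum_congr rfl fun i hi => ?_
    obtain ⟨hi1, hi2⟩ := Finset.mem_Icc.1 hi
    have hd := (sub_pos.2 (hα i hi1 hi2)).le
    rw [rlIntegral_rlIntegral hd h0 h1 hw ht, rlIntegral_rlIntegral h0 hd h1 hw ht, add_comm]
  · have htp := Real.rpow_pos_of_pos ht.1 (-γ)
    have hb : ∀ i ∈ Finset.Icc 1 m, |z i t| ≤ C i * (ε * X * Real.exp (l * t)) * t ^ (-γ) := by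
      intro i hi
      -- The multiplication bound at t only involves (0,t], where e^(ls) ≤ e^(lt); so it is
      -- compatible with the exponential weight.
      refine (hz i hi).2 t ht _ (by positivity) fun s hs => ?_
      have hsT : s ≤ T := hs.2.trans ht.2
      have hsp := Real.rpow_pos_of_pos hs.1 (-γ)
      refine (hl i hi w X s hX ⟨hs.1, hsT⟩ fun r hr => hwX r ⟨hr.1, hr.2.le.trans hsT⟩).trans ?_
      have := hs.2
      gcongr
    calc _ ≤ ∑ i ∈ Finset.Icc 1 m, |z i t| := Finset.abs_sum_le_sum_abs _ _
      _ ≤ ∑ i ∈ Finset.Icc 1 m, C i * (ε * X * Real.exp (l * t)) * t ^ (-γ) :=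
        Finset.sum_le_sum hb
      _ = ((∑ i ∈ Finset.Icc 1 m, C i) * ε) * X * Real.exp (l * t) * t ^ (-γ) := by
        rw [← Finset.sum_mul, ← Finset.sum_mul]; ring
      _ ≤ 1 / 2 * X * Real.exp (l * t) * t ^ (-γ) := by
        have : (∑ i ∈ Finset.Icc 1 m, C i) * ε ≤ 1 / 2 := by
          rw [hε, mul_one_div, div_le_div_iff₀ (by positivity) (by positivity)]
          linarith
        gcongr
      _ = _ := by ring

/-- The constant 1 is I^γ u with u a multiple of t^(-γ), so Φ_{j+1-α_i} = I^(j-α_i) 1 = I^γ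
I^(j-α_i) u lies in the range of I^γ. -/
theorem exists_isFracDerivOf_neumannSeed {m j : ℕ} {α : ℕ → ℝ} {a : ℕ → ℝ → ℝ} (h0 : 0 ≤ γ)
    (h1 : γ < 1) (hT : 0 < T) (ha : ∀ i, 1 ≤ i → i ≤ m → MemWeightedCn γ T 1 (a i))
    (hlow : ∀ i ∈ Finset.Icc (minLowOrder m α j) m, 1 ≤ i ∧ 0 ≤ α i ∧ α i ≤ j) :
    ∃ w, IsFracDerivOf γ T w (neumannSeed m α a T j) := by
  have hone := isFracDerivOf_rpow T h0 h1 le_rfl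
  simp only [Real.rpow_zero] at hone
  obtain ⟨u, hu⟩ : ∃ u, IsFracDerivOf γ T u fun _ => 1 := ⟨_, hone⟩
  have hz : ∀ i, ∃ z, i ∈ Finset.Icc (minLowOrder m α j) m →
      IsFracDerivOf γ T z (fun t => a i t * phiFrac j (α i) T t) := by
    intro i
    by_cases hi : i ∈ Finset.Icc (minLowOrder m α j) m
    · obtain ⟨hi1, hi2, hi3⟩ := hlow i hi
      have hd := sub_nonneg.2 hi3
      obtain ⟨C, -, hC⟩ := exists_isFracDerivOf_mul h0 h1 hT (ha i hi1 (Finset.mem_Icc.1 hi).2)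
      obtain ⟨z, hz, -⟩ := hC _ (hu.1.rlIntegral hd h1 hT)
      refine ⟨z, fun _ => hz.congr (fun _ _ => rfl) fun t ht => ?_⟩
      simp only
      rw [phiFrac_eqOn T hi2 hi3 ht, rlIntegral_rlIntegral h0 hd h1 hu.1 ht, add_comm,
        ← rlIntegral_rlIntegral hd h0 h1 hu.1 ht, rlIntegral_eqOn hu.2 ht]
    · exact ⟨0, fun h => absurd h hi⟩
  choose z hz using hz
  exact ⟨_, IsFracDerivOf.sum h0 h1 _ hz⟩

theorem exists_isFracDerivOf_neumannOp_iterate {m j : ℕ} {α : ℕ → ℝ} {a : ℕ → ℝ → ℝ} (h0 : 0 ≤ γ)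
    (h1 : γ < 1) (hT : 0 < T) (hα : ∀ i, 1 ≤ i → i ≤ m → α i < α 0)
    (ha : ∀ i, 1 ≤ i → i ≤ m → MemWeightedCn γ T 1 (a i))
    (hlow : ∀ i ∈ Finset.Icc (minLowOrder m α j) m, 1 ≤ i ∧ 0 ≤ α i ∧ α i ≤ j) :
    ∃ (W : ℕ → ℝ → ℝ) (Y : ℝ), 0 ≤ Y ∧
      (∀ k, IsFracDerivOf γ T (W k) ((neumannOp m α a)^[k] (neumannSeed m α a T j))) ∧
      ∀ k, ∀ t ∈ Ioc 0 T, |W k t| ≤ Y * (1 / 2) ^ k * t ^ (-γ) := by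
  obtain ⟨w, hw⟩ := exists_isFracDerivOf_neumannSeed h0 h1 hT ha hlow
  obtain ⟨l, hl0, hl⟩ := exists_isFracDerivOf_neumannOp h0 h1 hT hα ha
  choose! F hF hFb using hl
  obtain ⟨X, hX0, hX⟩ := hw.1.exists_bound
  have hW : ∀ k, IsFracDerivOf γ T (F^[k] w) ((neumannOp m α a)^[k] (neumannSeed m α a T j)) := by
    intro k
    induction k with
    | zero => exact hw
    | succ k ih =>
      rw [Function.iterate_succ_apply', Function.iterate_succ_apply']
      exact (hF _ ih.1).congr (fun _ _ => rfl) (neumannOp_eqOn fun t ht => (ih.2 ht).symm)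
  have hWb : ∀ k, ∀ t ∈ Ioc 0 T,
      |F^[k] w t| ≤ X * (1 / 2) ^ k * Real.exp (l * t) * t ^ (-γ) := by
    intro k
    induction k with
    | zero =>
      intro t ht
      have htp := Real.rpow_pos_of_pos ht.1 (-γ)
      refine (hX t ht).trans ?_
      have : 1 ≤ Real.exp (l * t) := Real.one_le_exp (mul_nonneg hl0 ht.1.le)
      rw [pow_zero, mul_one]
      exact mul_le_mul_of_nonneg_right (le_mul_of_one_le_right hX0 this) htp.le
    | succ k ih =>
      intro t ht
      rw [Function.iterate_succ_apply']
      refine (hFb _ (hW k).1 (X * (1 / 2) ^ k) (by positivity) ih t ht).trans_eq ?_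
      rw [pow_succ]
      ring
  -- On the bounded interval the exponential weight is absorbed into e^(lT).
  refine ⟨fun k => F^[k] w, X * Real.exp (l * T), by positivity, hW, fun k t ht => ?_⟩
  refine (hWb k t ht).trans ?_
  have htp := Real.rpow_pos_of_pos ht.1 (-γ)
  have : Real.exp (l * t) ≤ Real.exp (l * T) :=
    Real.exp_le_exp.2 (mul_le_mul_of_nonneg_left ht.2 hl0)
  rw [mul_right_comm X]
  gcongr

theorem MemWeightedC.exists_alternating_sum (hT : 0 < T) {W : ℕ → ℝ → ℝ} {Y : ℝ}
    (hW : ∀ k, MemWeightedC γ T (W k))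
    (hb : ∀ k, ∀ t ∈ Ioc 0 T, |W k t| ≤ Y * (1 / 2) ^ k * t ^ (-γ)) :
    ∃ w, MemWeightedC γ T w ∧ ∀ N : ℕ, ∀ t ∈ Ioc 0 T,
      |∑ k ∈ Finset.range N, (-1) ^ (k + 1) * W k t - w t| ≤ 2 * Y * (1 / 2) ^ N * t ^ (-γ) := by
  have hgeo : ∀ t ∈ Ioc 0 T, ∀ N, dist (∑ k ∈ Finset.range N, (-1) ^ (k + 1) * W k t)
      (∑ k ∈ Finset.range (N + 1), (-1) ^ (k + 1) * W k t) ≤ Y * t ^ (-γ) * (1 / 2) ^ N := by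
    intro t ht N
    rw [Finset.sum_range_succ, dist_self_add_right, Real.norm_eq_abs, abs_mul, abs_pow, abs_neg,
      abs_one, one_pow, one_mul]
    exact (hb N t ht).trans_eq (by ring)
  have hlim : ∀ t, ∃ l, t ∈ Ioc 0 T →
      Tendsto (fun N => ∑ k ∈ Finset.range N, (-1) ^ (k + 1) * W k t) atTop (𝓝 l) := by
    intro t
    by_cases ht : t ∈ Ioc 0 T
    · obtain ⟨l, hl⟩ := cauchySeq_tendsto_of_complete
        (cauchySeq_of_le_geometric _ _ (by norm_num) (hgeo t ht))
      exact ⟨l, fun _ => hl⟩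
    · exact ⟨0, fun h => absurd h ht⟩
  choose w hw using hlim
  have hbound : ∀ N : ℕ, ∀ t ∈ Ioc 0 T, |∑ k ∈ Finset.range N, (-1) ^ (k + 1) * W k t - w t| ≤
      2 * Y * (1 / 2) ^ N * t ^ (-γ) := by
    intro N t ht
    have := dist_le_of_le_geometric_of_tendsto _ _ (by norm_num) (hgeo t ht) (hw t ht) N
    rw [Real.dist_eq] at this
    exact this.trans_eq (by ring)
  refine ⟨w, MemWeightedC.of_approx hT fun ε hε => ?_, hbound⟩
  have hlim : Tendsto (fun N : ℕ => 2 * Y * (1 / 2 : ℝ) ^ N) atTop (𝓝 0) := by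
    simpa using (tendsto_pow_atTop_nhds_zero_of_lt_one (r := (1 / 2 : ℝ)) (by norm_num)
      (by norm_num)).const_mul (2 * Y)
  obtain ⟨N, hN⟩ := (hlim.eventually_le_const hε).exists
  refine ⟨_, MemWeightedC.sum (Finset.range N) fun k _ => (hW k).const_mul ((-1) ^ (k + 1)),
    fun t ht => ?_⟩
  rw [abs_sub_comm]
  exact (hbound N t ht).trans
    (mul_le_mul_of_nonneg_right hN (Real.rpow_pos_of_pos ht.1 _).le)

theorem tendsto_rlIntegral {α t : ℝ} (hα : 0 ≤ α) (h1 : γ < 1) (ht : t ∈ Ioc 0 T)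
    {S : ℕ → ℝ → ℝ} {w : ℝ → ℝ} {K : ℝ} (hK : 0 ≤ K) (hS : ∀ N, MemWeightedC γ T (S N))
    (hw : MemWeightedC γ T w)
    (h : ∀ N : ℕ, ∀ t ∈ Ioc 0 T, |S N t - w t| ≤ K * (1 / 2) ^ N * t ^ (-γ)) :
    Tendsto (fun N => rlIntegral α (S N) t) atTop (𝓝 (rlIntegral α w t)) := by
  rw [tendsto_iff_norm_sub_tendsto_zero]
  refine squeeze_zero (fun _ => norm_nonneg _)
    (fun N => abs_rlIntegral_sub_le hα h1 ht (by positivity) (hS N) hw (h N)) ?_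
  have := ((tendsto_pow_atTop_nhds_zero_of_lt_one (r := (1 / 2 : ℝ)) (by norm_num)
      (by norm_num)).const_mul K).mul_const (rlIntegralBound α γ T * t ^ (-γ))
  simp only [mul_zero, zero_mul] at this
  refine this.congr fun N => ?_
  ring

end

/-! ### The Volterra equation: existence, uniqueness and equivalence with (1). -/

section

variable {γ T : ℝ}

theorem exists_rlIntegral_eq_neumannOp {m j : ℕ} {α : ℕ → ℝ} {a : ℕ → ℝ → ℝ} (h0 : 0 ≤ γ)
    (h1 : γ < 1) (hT : 0 < T) (hα : ∀ i, 1 ≤ i → i ≤ m → α i < α 0)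
    {W : ℕ → ℝ → ℝ} {Y : ℝ} (hY : 0 ≤ Y)
    (hW : ∀ k, IsFracDerivOf γ T (W k) ((neumannOp m α a)^[k] (neumannSeed m α a T j)))
    (hb : ∀ k, ∀ t ∈ Ioc 0 T, |W k t| ≤ Y * (1 / 2) ^ k * t ^ (-γ)) :
    ∃ w, MemWeightedC γ T w ∧ (∀ N : ℕ, ∀ t ∈ Ioc 0 T,
        |∑ k ∈ Finset.range N, (-1) ^ (k + 1) * W k t - w t| ≤ 2 * Y * (1 / 2) ^ N * t ^ (-γ)) ∧
      ∀ t ∈ Ioc 0 T, rlIntegral γ w t =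
        -(neumannSeed m α a T j t + neumannOp m α a (rlIntegral γ w) t) := by
  obtain ⟨w, hw, hwS⟩ := MemWeightedC.exists_alternating_sum hT (fun k => (hW k).1) hb
  refine ⟨w, hw, hwS, fun t ht => ?_⟩
  set S : ℕ → ℝ → ℝ := fun N t => ∑ k ∈ Finset.range N, (-1) ^ (k + 1) * W k t with hS
  have hSM : ∀ N, MemWeightedC γ T (S N) := fun N =>
    MemWeightedC.sum (Finset.range N) fun k _ => (hW k).1.const_mul ((-1) ^ (k + 1))
  have hIS : ∀ β, 0 ≤ β → ∀ N, rlIntegral β (S N) t =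
      ∑ k ∈ Finset.range N, (-1) ^ (k + 1) * rlIntegral β (W k) t := fun β hβ N => by
    rw [hS, rlIntegral_sum hβ h1 ht _ fun k _ => (hW k).1.const_mul ((-1) ^ (k + 1))]
    exact Finset.sum_congr rfl fun k _ => rlIntegral_const_mul _ _ _
  have hpos : ∀ i ∈ Finset.Icc 1 m, 0 ≤ α 0 - α i + γ := fun i hi => by
    obtain ⟨hi1, hi2⟩ := Finset.mem_Icc.1 hi
    linarith [hα i hi1 hi2]
  have hY2 : 0 ≤ 2 * Y := by positivity
  set L := neumannOp m α a with hL
  have hLS : ∀ N, L (rlIntegral γ (S N)) t = ∑ k ∈ Finset.range N, (-1) ^ (k + 1) *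
      (L^[k + 1] (neumannSeed m α a T j)) t := by
    intro N
    rw [hL, neumannOp_rlIntegral a h0 h1 hα (hSM N) ht]
    calc _ = ∑ i ∈ Finset.Icc 1 m, ∑ k ∈ Finset.range N, (-1) ^ (k + 1) *
          (a i t * rlIntegral (α 0 - α i + γ) (W k) t) := by
          refine Finset.sum_congr rfl fun i hi => ?_
          rw [hIS _ (hpos i hi), Finset.mul_sum]
          exact Finset.sum_congr rfl fun k _ => by ring
      _ = _ := by
          rw [Finset.sum_comm]
          refine Finset.sum_congr rfl fun k _ => ?_
          rw [← Finset.mul_sum, Function.iterate_succ_apply', ← neumannOp_eqOn (hW k).2 ht,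
            neumannOp_rlIntegral a h0 h1 hα (hW k).1 ht]
  have hlim1 : Tendsto (fun N => L (rlIntegral γ (S N)) t) atTop (𝓝 (L (rlIntegral γ w) t)) := by
    simp_rw [hL, neumannOp_rlIntegral a h0 h1 hα (hSM _) ht,
      neumannOp_rlIntegral a h0 h1 hα hw ht]
    exact tendsto_finsetSum _ fun i hi =>
      (tendsto_rlIntegral (hpos i hi) h1 ht hY2 hSM hw hwS).const_mul _
  have hlim2 := (tendsto_rlIntegral h0 h1 ht hY2 hSM hw hwS).comp (tendsto_add_atTop_nat 1)
  -- The alternating signs make consecutive partial sums cancel exactly, except for the k = 0 term;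
  -- the equation then follows by letting N tend to infinity.
  have hconst : ∀ N, rlIntegral γ (S (N + 1)) t + L (rlIntegral γ (S N)) t =
      -neumannSeed m α a T j t := by
    intro N
    rw [hLS, hIS γ h0, Finset.sum_range_succ', add_right_comm, ← Finset.sum_add_distrib,
      Finset.sum_eq_zero, zero_add, (hW 0).2 ht]
    · simp
    · intro k _
      rw [(hW (k + 1)).2 ht]
      ring
  have hlim := hlim2.add hlim1
  simp only [Function.comp_def, hconst] at hlim
  have := tendsto_nhds_unique hlim tendsto_const_nhds
  linarith

/-- Each use of v = -L v halves the bound V e^(lt) when l is large. This needs only boundedness of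
v, and the weight exponent is 0. -/
theorem eqOn_zero_of_rlIntegral_eq_neg_neumannOp {m : ℕ} {α : ℕ → ℝ} {a : ℕ → ℝ → ℝ} (hT : 0 < T)
    (hα : ∀ i, 1 ≤ i → i ≤ m → α i < α 0) (ha : ∀ i, 1 ≤ i → i ≤ m → ContinuousOn (a i) (Icc 0 T))
    {v : ℝ → ℝ} {V : ℝ} (hV0 : 0 ≤ V) (hV : ∀ t ∈ Ioo 0 T, |v t| ≤ V)
    (hv : ∀ t ∈ Ioo 0 T, v t = -neumannOp m α a v t) : EqOn v (fun _ => 0) (Ioo 0 T) := by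
  have hA : ∀ i, ∃ A, 0 ≤ A ∧ (i ∈ Finset.Icc 1 m → ∀ t ∈ Ioo 0 T, |a i t| ≤ A) := by
    intro i
    by_cases hi : i ∈ Finset.Icc 1 m
    · obtain ⟨hi1, hi2⟩ := Finset.mem_Icc.1 hi
      obtain ⟨A, hA⟩ := isCompact_Icc.exists_bound_of_continuousOn (ha i hi1 hi2)
      exact ⟨max A 0, le_max_right _ _, fun _ t ht =>
        (hA t (Ioo_subset_Icc_self ht)).trans (le_max_left _ _)⟩
    · exact ⟨0, le_rfl, fun h => absurd h hi⟩
  choose A hA0 hA using hA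
  have hS : 0 ≤ ∑ i ∈ Finset.Icc 1 m, A i := Finset.sum_nonneg fun i _ => hA0 i
  set ε := 1 / (2 * (∑ i ∈ Finset.Icc 1 m, A i + 1)) with hε
  have hε0 : 0 < ε := by positivity
  have hev : ∀ᶠ l in atTop, ∀ i ∈ Finset.Icc 1 m, ∀ (f : ℝ → ℝ) (X t : ℝ), 0 ≤ X →
      t ∈ Ioc 0 T → (∀ s ∈ Ioo 0 t, |f s| ≤ X * Real.exp (l * s) * s ^ (-0 : ℝ)) →
      |rlIntegral (α 0 - α i) f t| ≤ ε * X * Real.exp (l * t) * t ^ (-0 : ℝ) := by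
    rw [Filter.eventually_all_finset]
    intro i hi
    obtain ⟨hi1, hi2⟩ := Finset.mem_Icc.1 hi
    exact eventually_abs_rlIntegral_le zero_lt_one hT (sub_pos.2 (hα i hi1 hi2)) hε0
  obtain ⟨l, hl, hl0⟩ := (hev.and (eventually_ge_atTop 0)).exists
  simp only [neg_zero, Real.rpow_zero, mul_one] at hl
  have hk : ∀ k : ℕ, ∀ t ∈ Ioo 0 T, |v t| ≤ V * (1 / 2) ^ k * Real.exp (l * t) := by
    intro k
    induction k with
    | zero =>
      intro t ht
      rw [pow_zero, mul_one]
      exact (hV t ht).trans (le_mul_of_one_le_right hV0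
        (Real.one_le_exp (mul_nonneg hl0 ht.1.le)))
    | succ k ih =>
      intro t ht
      rw [hv t ht, abs_neg]
      calc _ ≤ ∑ i ∈ Finset.Icc 1 m, |a i t * rlIntegral (α 0 - α i) v t| :=
            Finset.abs_sum_le_sum_abs _ _
        _ ≤ ∑ i ∈ Finset.Icc 1 m, A i * (ε * (V * (1 / 2) ^ k) * Real.exp (l * t)) := by
            refine Finset.sum_le_sum fun i hi => ?_
            rw [abs_mul]
            exact mul_le_mul (hA i hi t ht) (hl i hi v _ t (by positivity)
              (Ioo_subset_Ioc_self ht) fun s hs => ih s ⟨hs.1, hs.2.trans ht.2⟩) (abs_nonneg _)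
              (hA0 i)
        _ = ((∑ i ∈ Finset.Icc 1 m, A i) * ε) * (V * (1 / 2) ^ k) * Real.exp (l * t) := by
            rw [← Finset.sum_mul]; ring
        _ ≤ 1 / 2 * (V * (1 / 2) ^ k) * Real.exp (l * t) := by
            have : (∑ i ∈ Finset.Icc 1 m, A i) * ε ≤ 1 / 2 := by
              rw [hε, mul_one_div, div_le_div_iff₀ (by positivity) (by positivity)]
              linarith
            gcongr
        _ = _ := by rw [pow_succ]; ring
  intro t ht
  have hlim : Tendsto (fun k : ℕ => V * (1 / 2 : ℝ) ^ k * Real.exp (l * t)) atTop (𝓝 0) := by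
    simpa using ((tendsto_pow_atTop_nhds_zero_of_lt_one (r := (1 / 2 : ℝ)) (by norm_num)
      (by norm_num)).const_mul V).mul_const (Real.exp (l * t))
  exact abs_nonpos_iff.1 (ge_of_tendsto' hlim fun k => hk k t ht)

/-- The difference v = I^γ (w - w') is bounded and solves the homogeneous equation, hence vanishes,
and I^n (w - w') = I^α₀ v. As α₀ > 0, knowing v on the open interval is enough. -/
theorem rlIntegral_natCast_eq_of_rlIntegral_eq {m n : ℕ} {α : ℕ → ℝ} {a : ℕ → ℝ → ℝ} {r : ℝ → ℝ}
    (h0 : 0 ≤ γ) (h1 : γ < 1) (hT : 0 < T) (hn : γ = n - α 0) (hα0 : 0 < α 0)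
    (hα : ∀ i, 1 ≤ i → i ≤ m → α i < α 0) (ha : ∀ i, 1 ≤ i → i ≤ m → ContinuousOn (a i) (Icc 0 T))
    {w w' : ℝ → ℝ} (hw : MemWeightedC γ T w) (hw' : MemWeightedC γ T w')
    (h : ∀ t ∈ Ioo 0 T, rlIntegral γ w t = -(r t + neumannOp m α a (rlIntegral γ w) t))
    (h' : ∀ t ∈ Ioo 0 T, rlIntegral γ w' t = -(r t + neumannOp m α a (rlIntegral γ w') t)) :
    EqOn (rlIntegral n w) (rlIntegral n w') (Icc 0 T) := by
  have hn0 : (n : ℝ) ≠ 0 := by linarith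
  have hd := hw.sub hw'
  obtain ⟨X, hX0, hX⟩ := hd.exists_bound
  have hΓ := Real.Gamma_pos_of_pos (sub_pos.2 h1)
  have hzero := eqOn_zero_of_rlIntegral_eq_neg_neumannOp (m := m) (α := α) (a := a) hT hα ha
    (v := rlIntegral γ fun t => w t - w' t) (V := X * Real.Gamma (1 - γ)) (by positivity)
    (fun t ht => abs_rlIntegral_self_le h0 h1 ht.1 fun s hs => hX s ⟨hs.1, hs.2.trans ht.2.le⟩) (by
      intro t ht
      have ht' := Ioo_subset_Ioc_self ht
      rw [rlIntegral_sub h0 h1 ht' hw hw', h t ht, h' t ht,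
        neumannOp_rlIntegral a h0 h1 hα hw ht', neumannOp_rlIntegral a h0 h1 hα hw' ht',
        neumannOp_rlIntegral a h0 h1 hα hd ht']
      have hsum : ∑ i ∈ Finset.Icc 1 m, a i t * rlIntegral (α 0 - α i + γ) (fun s => w s - w' s) t =
          ∑ i ∈ Finset.Icc 1 m, (a i t * rlIntegral (α 0 - α i + γ) w t -
            a i t * rlIntegral (α 0 - α i + γ) w' t) := by
        refine Finset.sum_congr rfl fun i hi => ?_
        obtain ⟨hi1, hi2⟩ := Finset.mem_Icc.1 hi
        rw [rlIntegral_sub (by linarith [hα i hi1 hi2]) h1 ht' hw hw', mul_sub]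
      simp only
      rw [hsum, Finset.sum_sub_distrib]
      ring)
  intro t ht
  rcases ht.1.eq_or_lt with rfl | ht0
  · rw [rlIntegral_apply_zero hn0, rlIntegral_apply_zero hn0]
  · have ht' : t ∈ Ioc 0 T := ⟨ht0, ht.2⟩
    rw [← sub_eq_zero, ← rlIntegral_sub n.cast_nonneg h1 ht' hw hw',
      show (n : ℝ) = α 0 + γ by rw [hn]; ring, ← rlIntegral_rlIntegral hα0.le h0 h1 hd ht',
      rlIntegral_congr_Ioo hα0.ne' ht0.le (hzero.mono (Ioo_subset_Ioo_right ht.2)),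
      rlIntegral_zero_fun]

theorem isSolution_iff {m n j : ℕ} {α : ℕ → ℝ} {a : ℕ → ℝ → ℝ} (h0 : 0 ≤ γ)
    (h1 : γ < 1) (hT : 0 < T) (hn : γ = n - α 0) (hnn : ∀ i ≤ m, 0 ≤ α i)
    (hα : ∀ i, 1 ≤ i → i ≤ m → α i < α 0) (hj : j < n)
    (hlow : ∀ i, i ∈ Finset.Icc (minLowOrder m α j) m ↔ i ∈ Finset.Icc 1 m ∧ α i ≤ j)
    {y w : ℝ → ℝ} (hw : MemWeightedC γ T w)
    (hy : EqOn y (fun t => phi j t + rlIntegral n w t) (Icc 0 T)) :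
    IsSolution m α a T y ↔ ∀ t ∈ Ioo 0 T, rlIntegral γ w t =
      -(neumannSeed m α a T j t + neumannOp m α a (rlIntegral γ w) t) := by
  have hceil : ∀ i ≤ m, ⌈α i⌉₊ ≤ n := fun i hi => Nat.ceil_le.2 <| by
    rcases i.eq_zero_or_pos with rfl | h
    · linarith
    · linarith [hα i h hi]
  have hcap := fun i hi => caputoDeriv_of_eqOn_phi_add h0 h1 hT (hnn i hi) hj (hceil i hi) hw hy
  rw [IsSolution, and_iff_right fun i hi => (hcap i hi).1]
  refine forall₂_congr fun t ht => ?_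
  have ht' := Ioo_subset_Ioc_self ht
  -- α₀ = n - γ > n - 1 ≥ j, so Φ_{j+1} does not contribute to the leading derivative, which is just
  -- I^γ w.
  have hj' : ¬ ⌈α 0⌉₊ ≤ j := fun h => by
    have h2 := Nat.ceil_le.1 h
    have h3 : (j : ℝ) + 1 ≤ n := by exact_mod_cast hj
    linarith
  rw [(hcap 0 m.zero_le).2 t ht', if_neg hj', zero_add, ← hn,
    neumannOp_rlIntegral a h0 h1 hα hw ht']
  have hseed : neumannSeed m α a T j t = ∑ i ∈ Finset.Icc 1 m,
      a i t * (if ⌈α i⌉₊ ≤ j then phiFrac j (α i) T t else 0) := by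
    have : Finset.Icc (minLowOrder m α j) m = (Finset.Icc 1 m).filter fun i => ⌈α i⌉₊ ≤ j := by
      ext i
      rw [Finset.mem_filter, Nat.ceil_le, hlow]
    rw [neumannSeed, this, Finset.sum_filter]
    simp_rw [mul_ite, mul_zero]
  rw [hseed, ← Finset.sum_add_distrib]
  have hsum : ∑ i ∈ Finset.Icc 1 m, a i t * caputoDeriv (α i) T y t = ∑ i ∈ Finset.Icc 1 m,
      (a i t * (if ⌈α i⌉₊ ≤ j then phiFrac j (α i) T t else 0) +
        a i t * rlIntegral (α 0 - α i + γ) w t) := by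
    refine Finset.sum_congr rfl fun i hi => ?_
    rw [(hcap i (Finset.mem_Icc.1 hi).2).2 t ht', mul_add,
      show (n : ℝ) - α i = α 0 - α i + γ by rw [hn]; ring]
  rw [hsum]

/-! ### Convergence of the partial sums in C^n_γ. -/

theorem MemWeightedCn.congr {n : ℕ} {f g : ℝ → ℝ} (hf : MemWeightedCn γ T n f)
    (h : EqOn g f (Icc 0 T)) : MemWeightedCn γ T n g := by
  have hi : ∀ k, EqOn (iteratedDerivWithin k g (Icc 0 T)) (iteratedDerivWithin k f (Icc 0 T))
      (Icc 0 T) := fun k _ ht => iteratedDerivWithin_congr h ht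
  cases n with
  | zero => exact MemWeightedC.congr hf (h.mono Ioc_subset_Icc_self)
  | succ k =>
    exact ⟨hf.1.congr h, fun t ht => (hf.2.1 t ht).congr (hi k) (hi k (Ioc_subset_Icc_self ht)),
      hf.2.2.congr ((hi (k + 1)).mono Ioc_subset_Icc_self)⟩

theorem MemWeightedCn.continuousOn_iteratedDerivWithin {n k : ℕ} (hT : 0 < T) {f : ℝ → ℝ}
    (hf : MemWeightedCn γ T n f) (hk : k < n) :
    ContinuousOn (iteratedDerivWithin k f (Icc 0 T)) (Icc 0 T) := by
  obtain ⟨N, rfl⟩ : ∃ N, n = N + 1 := ⟨n - 1, by omega⟩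
  exact hf.1.continuousOn_iteratedDerivWithin (by exact_mod_cast Nat.lt_succ_iff.1 hk)
    (uniqueDiffOn_Icc hT)

theorem tendsto_nhdsGT_zero_of_continuousOn {u : ℝ → ℝ} (hT : 0 < T)
    (hu : ContinuousOn u (Icc 0 T)) : Tendsto u (𝓝[>] 0) (𝓝 (u 0)) :=
  (hu 0 (left_mem_Icc.2 hT.le)).mono_left
    (nhdsWithin_le_of_mem (Icc_mem_nhdsGT hT))

theorem tendstoUniformlyOn_of_le_geometric {F : ℕ → ℝ → ℝ} {f : ℝ → ℝ} {s : Set ℝ} {K : ℝ}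
    (h : ∀ N : ℕ, ∀ t ∈ s, |F N t - f t| ≤ K * (1 / 2) ^ N) :
    TendstoUniformlyOn F f atTop s := by
  rw [Metric.tendstoUniformlyOn_iff]
  intro ε hε
  have hlim : Tendsto (fun N : ℕ => K * (1 / 2 : ℝ) ^ N) atTop (𝓝 0) := by
    simpa using (tendsto_pow_atTop_nhds_zero_of_lt_one (r := (1 / 2 : ℝ)) (by norm_num)
      (by norm_num)).const_mul K
  filter_upwards [hlim.eventually_lt_const hε] with N hN t ht
  rw [dist_comm, Real.dist_eq]
  exact (h N t ht).trans_lt hN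

/-- The k-th derivatives differ by I^(n-k)(S_N - w), of size at most a constant times 2^(-N)
t^(n-k-γ) with positive exponent for k < n; the n-th derivatives differ by S_N - w itself on (0,T].
-/
theorem tendstoInWeightedCn_phi_add (h1 : γ < 1) (hT : 0 < T) {n j : ℕ} (hj : j < n)
    {F S : ℕ → ℝ → ℝ} {w : ℝ → ℝ} {K : ℝ} (hK : 0 ≤ K)
    (hF : ∀ N, EqOn (F N) (fun t => phi j t + rlIntegral n (S N) t) (Icc 0 T))
    (hS : ∀ N, MemWeightedC γ T (S N)) (hw : MemWeightedC γ T w)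
    (h : ∀ N : ℕ, ∀ t ∈ Ioc 0 T, |S N t - w t| ≤ K * (1 / 2) ^ N * t ^ (-γ)) :
    TendstoInWeightedCn γ T n F (fun t => phi j t + rlIntegral n w t) := by
  refine ⟨fun N => (memWeightedCn_phi_add h1 hT (hS N) hj).congr (hF N),
    memWeightedCn_phi_add h1 hT hw hj, fun k hk => ?_, ?_⟩
  · have hk' : (k : ℝ) + 1 ≤ n := by exact_mod_cast hk
    have hp : 0 < (n : ℝ) - k := by linarith
    have hΓ := Real.Gamma_pos_of_pos (sub_pos.2 h1)
    have hΓ' := Real.Gamma_pos_of_pos (show 0 < 1 - γ + (n - k) by linarith)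
    refine tendstoUniformlyOn_of_le_geometric (K := K * (Real.Gamma (1 - γ) /
      Real.Gamma (1 - γ + (n - k)) * T ^ ((n : ℝ) - k - γ))) fun N t ht => ?_
    rw [iteratedDerivWithin_congr (hF N) ht, iteratedDerivWithin_phi_add h1 hT (hS N) hk ht,
      iteratedDerivWithin_phi_add h1 hT hw hk ht, phiAddDeriv, phiAddDeriv, add_sub_add_left_eq_sub]
    rcases ht.1.eq_or_lt with rfl | ht0
    · rw [rlIntegral_apply_zero hp.ne', rlIntegral_apply_zero hp.ne', sub_self, abs_zero]
      have := Real.rpow_pos_of_pos hT ((n : ℝ) - k - γ)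
      positivity
    · have ht' : t ∈ Ioc 0 T := ⟨ht0, ht.2⟩
      rw [← rlIntegral_sub hp.le h1 ht' (hS N) hw]
      refine (abs_rlIntegral_le hp.le h1 ht0
        fun s hs => h N s ⟨hs.1, hs.2.trans ht.2⟩).trans ?_
      have : t ^ ((n : ℝ) - k - γ) ≤ T ^ ((n : ℝ) - k - γ) :=
        Real.rpow_le_rpow ht0.le ht.2 (by linarith)
      calc _ ≤ K * (1 / 2) ^ N * (Real.Gamma (1 - γ) / Real.Gamma (1 - γ + (n - k))) *
            T ^ ((n : ℝ) - k - γ) := by gcongr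
        _ = _ := by ring
  · refine tendstoUniformlyOn_of_le_geometric (K := K) fun N t ht => ?_
    have ht' := Ioc_subset_Icc_self ht
    rw [iteratedDerivWithin_congr (hF N) ht', iteratedDerivWithin_phi_add_self h1 hT (hS N) hj ht,
      iteratedDerivWithin_phi_add_self h1 hT hw hj ht, ← mul_sub, ← abs_le_rpow_neg_iff ht.1]
    exact h N t ht

theorem neumannPartialSum_eqOn {m n j : ℕ} {α : ℕ → ℝ} {a : ℕ → ℝ → ℝ} (h0 : 0 ≤ γ)
    (h1 : γ < 1) (hn : γ = n - α 0) (hα0 : 0 < α 0) {W : ℕ → ℝ → ℝ}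
    (hW : ∀ k, IsFracDerivOf γ T (W k) ((neumannOp m α a)^[k] (neumannSeed m α a T j))) (N : ℕ) :
    EqOn (neumannPartialSum m α a T j N) (fun t => phi j t +
      rlIntegral n (fun s => ∑ k ∈ Finset.range N, (-1) ^ (k + 1) * W k s) t) (Icc 0 T) := by
  have hn0 : (n : ℝ) ≠ 0 := by linarith
  intro t ht
  simp only [neumannPartialSum]
  congr 1
  rcases ht.1.eq_or_lt with rfl | ht0
  · simp [rlIntegral_apply_zero hn0, rlIntegral_apply_zero hα0.ne']
  · have ht' : t ∈ Ioc 0 T := ⟨ht0, ht.2⟩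
    rw [rlIntegral_sum n.cast_nonneg h1 ht' _ fun k _ => (hW k).1.const_mul ((-1) ^ (k + 1))]
    refine Finset.sum_congr rfl fun k _ => ?_
    rw [rlIntegral_const_mul, ← rlIntegral_eqOn (hW k).2 ht',
      rlIntegral_rlIntegral hα0.le h0 h1 (hW k).1 ht', hn, add_sub_cancel]

end

/-! ### The order of the exponents, and the theorem. -/

theorem lt_of_forall_succ_lt_of_le {m : ℕ} {α : ℕ → ℝ} (hα : ∀ i < m, α (i + 1) < α i) {i k : ℕ}
    (hik : i < k) (hk : k ≤ m) : α k < α i := by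
  induction k, hik using Nat.le_induction with
  | base => exact hα i hk
  | succ l hl ih => exact (hα l hk).trans (ih (by omega))

/-- The α_i decrease, so the indices with α_i ≤ j form a final segment. Since H_0 is contained in
H_j, the infimum is attained and is not the default value 0 of an empty set. -/
theorem mem_Icc_minLowOrder {m : ℕ} {α : ℕ → ℝ} (hα : ∀ i < m, α (i + 1) < α i) (hαm : 0 ≤ α m)
    (hH : (lowOrders m α 0).Nonempty) (j i : ℕ) :
    i ∈ Finset.Icc (minLowOrder m α j) m ↔ i ∈ Finset.Icc 1 m ∧ α i ≤ j := by
  have hne : (lowOrders m α j).Nonempty := by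
    obtain ⟨i, h1, h2, h3, h4⟩ := hH
    exact ⟨i, h1, h2, h3, h4.trans (by simp)⟩
  obtain ⟨h1, h2, -, h4⟩ : minLowOrder m α j ∈ lowOrders m α j := Nat.sInf_mem hne
  simp only [Finset.mem_Icc]
  constructor
  · rintro ⟨hi, him⟩
    refine ⟨⟨h1.trans hi, him⟩, ?_⟩
    rcases hi.eq_or_lt with h | h
    · rwa [← h]
    · exact (lt_of_forall_succ_lt_of_le hα h him).le.trans h4
  · rintro ⟨⟨hi, him⟩, hij⟩
    refine ⟨Nat.sInf_le ⟨hi, him, ?_, hij⟩, him⟩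
    rcases him.eq_or_lt with rfl | h
    · exact hαm
    · exact hαm.trans (lt_of_forall_succ_lt_of_le hα h le_rfl).le

theorem theorem1 (m : ℕ) (T : ℝ) (hT : 0 < T)
    (α : ℕ → ℝ) (n : ℕ → ℕ) (a : ℕ → ℝ → ℝ)
    (hα : ∀ i < m, α (i + 1) < α i) (hαm : 0 ≤ α m)
    (hn : ∀ i ≤ m, (n i : ℝ) - 1 < α i ∧ α i ≤ n i)
    (hH : (lowOrders m α 0).Nonempty)
    (hn01 : n 0 = n 1)
    (γ : ℝ) (hγ : γ = n 0 - α 0)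
    (ha : ∀ i, 1 ≤ i → i ≤ m → MemWeightedCn γ T 1 (a i))
    (hDa : ∀ i, 1 ≤ i → i ≤ m → MemWeightedC 0 T (rlDeriv γ T (a i))) :
    ∃ y : Fin (n 0) → ℝ → ℝ,
      IsCanonicalFundamentalSystem m α a T (n 0) y ∧
      (∀ j, MemWeightedCn γ T (n 0) (y j)) ∧
      (∀ z : Fin (n 0) → ℝ → ℝ, IsCanonicalFundamentalSystem m α a T (n 0) z →
        (∀ j, MemWeightedCn γ T (n 0) (z j)) → ∀ j, EqOn (z j) (y j) (Icc 0 T)) ∧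
      (∀ j : Fin (n 0),
        TendstoInWeightedCn γ T (n 0) (neumannPartialSum m α a T j) (y j)) := by
  have hn0 := hn 0 m.zero_le
  have h0 : 0 ≤ γ := by linarith
  have h1 : γ < 1 := by linarith
  have hlt : ∀ i, 1 ≤ i → i ≤ m → α i < α 0 := fun i hi him => lt_of_forall_succ_lt_of_le hα hi him
  have hnn : ∀ i ≤ m, 0 ≤ α i := fun i him => by
    rcases him.eq_or_lt with rfl | h
    · exact hαm
    · exact hαm.trans (lt_of_forall_succ_lt_of_le hα h le_rfl).le
  have hα0 : 0 < α 0 := by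
    obtain ⟨i, hi, him, hi0, -⟩ := hH
    exact hi0.trans_lt (hlt i hi him)
  have hlow := mem_Icc_minLowOrder hα hαm hH
  have hac : ∀ i, 1 ≤ i → i ≤ m → ContinuousOn (a i) (Icc 0 T) := fun i hi him =>
    (ha i hi him).1.continuousOn
  have hW := fun j : ℕ => exists_isFracDerivOf_neumannOp_iterate (j := j) h0 h1 hT hlt ha
    fun i hi => by
      obtain ⟨h, hij⟩ := (hlow j i).1 hi
      obtain ⟨hi1, him⟩ := Finset.mem_Icc.1 h
      exact ⟨hi1, hnn i him, hij⟩
  choose W Y hY hW hWb using hW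
  have hw := fun j : ℕ => exists_rlIntegral_eq_neumannOp h0 h1 hT hlt (hY j) (hW j) (hWb j)
  choose w hw hwS hwsol using hw
  refine ⟨fun j t => phi j t + rlIntegral (n 0 : ℝ) (w j) t, fun j => ⟨?_, fun k => ?_⟩,
    fun j => memWeightedCn_phi_add h1 hT (hw j) j.2, fun z hz hzM j => ?_, fun j => ?_⟩
  · exact (isSolution_iff h0 h1 hT hγ hnn hlt j.2 (hlow j) (hw j) fun _ _ => rfl).2
      fun t ht => hwsol j t (Ioo_subset_Ioc_self ht)
  · have hM := memWeightedCn_phi_add h1 hT (hw j) j.2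
    have := tendsto_nhdsGT_zero_of_continuousOn hT (hM.continuousOn_iteratedDerivWithin hT k.2)
    rw [iteratedDerivWithin_phi_add h1 hT (hw j) k.2 (left_mem_Icc.2 hT.le),
      phiAddDeriv_apply_zero k.2] at this
    simpa only [Fin.ext_iff] using this
  -- Derivatives of order below n₀ are continuous at 0, so the prescribed limits are values at 0 and
  -- Taylor's formula puts z j in the form Φ_{j+1} + I^n w.
  · obtain ⟨hzsol, hzinit⟩ := hz j
    obtain ⟨hv, hzv⟩ := (hzM j).eqOn_phi_add h1 hT j.2 fun k hk => by
      have h2 := tendsto_nhdsGT_zero_of_continuousOn hT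
        ((hzM j).continuousOn_iteratedDerivWithin hT hk)
      simpa only [Fin.ext_iff] using tendsto_nhds_unique h2 (hzinit ⟨k, hk⟩)
    have hzeq := (isSolution_iff h0 h1 hT hγ hnn hlt j.2 (hlow j) hv hzv).1 hzsol
    have := rlIntegral_natCast_eq_of_rlIntegral_eq h0 h1 hT hγ hα0 hlt hac hv (hw j) hzeq
      fun t ht => hwsol j t (Ioo_subset_Ioc_self ht)
    intro t ht
    rw [hzv ht]
    simp only
    rw [this ht]
  · exact tendstoInWeightedCn_phi_add h1 hT j.2 (mul_nonneg zero_le_two (hY j))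
      (neumannPartialSum_eqOn h0 h1 hγ hα0 (hW j))
      (fun N => MemWeightedC.sum _ fun k _ => (hW j k).1.const_mul _) (hw j) (hwS j)
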